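/- Let $1\le K\le N$, $L\ge 1$, $q\in[0,1]$, write $d_s=\min(s+L-1,K)$, and put $$T=\sum_{s=1}^{K}\frac{\binom{K}{d_s}q^{s-1}(1-q)^{K-s+1}}{\binom{K-s}{d_s-s}}\binom{d_s-1}{s-1},\qquad M_D=Nq,\qquad M_K=\sum_{s=1}^{K}\frac{\binom{K-1}{d_s-1}\binom{d_s-1}{s-1}}{\binom{K-s}{d_s-s}}\,q^{s-1}(1-q)^{K-s+1}.$$ **Setting.** A library has $N$ files $W_1,\dots,W_N$ of $F=mf$ bits, i.e. $f$ symbols over a field $\mathbb F$ with $2^m$ elements (strings of $m$ bits are identified with elements of $\mathbb F$ by any bijection). There are $L$ transmitters, $K$ users with channel rows $h_1,\dots,h_K\in\mathbb F^L$, and an eavesdropper with channel $h_e\in\mathbb F^L$. When $x(n)\in\mathbb F^L$ is sent in time slot $n$, user $k$ receives $h_k\cdot x(n)$ and the eavesdropper receives $y_e(n)=h_e\cdot x(n)$. All channel entries are independent and uniform on $\mathbb F$, and constant during delivery. **Scheme.** *Placement.* Each user $k$ independently caches, for each file $n$, a uniformly random set of $\lfloor qF\rfloor$ of its bits. For $\tau\subseteq[K]$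 let $W_{n,\tau}$ be the string of bits of file $n$ cached by exactly the users in $\tau$. It is padded and split into $\binom{K-s}{d_s-s}$ mini-files of equally many symbols, where $s=|\tau|+1$. *Keys.* For all $s\in[K]$, $S\subseteq[K]$ with $|S|=d_s$, and $\omega=1,\dots,\binom{d_s-1}{s-1}$, an independent uniform key $\kappa_{s,S,\omega}$ over $\mathbb F$ is placed at every user of $S$; its length is that of the longest block $(s,S,\omega)$ over all demands. *Delivery.* Given a demand vector $d=(d(1),\dots,d(K))\in[N]^K$, for all such $(s,S,\omega)$ the transmitters send the block $$x_{s,\omega}(S)=\sum_{U\subseteq S,\ |U|=s}\Big(\sum_{r\in U}\varphi^{s,\omega}_{S,U,r}\,W^{c(U,S)}_{d(r),\,U\setminus\{r\}}\Big)u_S^U+\kappa_{s,S,\omega}\,(1,\dots,1)^{T},$$ where mini-files are zero-padded to the longest one in the block, which is the length of the block, the coefficients $\varphi$ are independent and uniform on $\mathbb F$, the superscript $c(U,S)$ runs through all mini-files as $S$ runs through the $d_s$-sets containing $U$, and the beamforming vectors $u_S^U\in\mathbb F^L$ satisfy $h_j\cdot u_S^U=0$ for $j\in S\setminus U$ and $h_j\cdot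 u_S^U\ne0$ for $j\in U$. **Claim.** For all $\varepsilon,\delta>0$ there are $m_0,f_0$ such that for all $m\ge m_0$ and $f\ge f_0$, with probability at least $1-\varepsilon$ over the placement, the channels $h_1,\dots,h_K,h_e$ and the coefficients $\varphi$, all of the following hold: 1. beamforming vectors as above exist; and for every choice of them and every demand vector $d$, each user $k$ recovers $W_{d(k)}$ without error from its received signal and its cached bits and keys, and $I(y_e;W_1,\dots,W_N)=0$ for the whole signal $y_e$ of the eavesdropper and every probability law of the files (the keys being independent of the files); 2. the number of time slots of the worst demand vector, divided by $f$, differs from $T$ by at most $\delta$; 3. every user stores exactly $N\lfloor qF\rfloor$ file bits, and its numbers of stored file bits and of stored key bits, divided by $F$, differ from $M_D$ and from $M_K$, respectively, by at most $\delta$. -/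

import Mathlib

noncomputable section

namespace SecureCaching

/-! ### Entropy and mutual information of finitely supported laws -/

/-- Shannon entropy (in bits) of a probability law on a finite type. -/
def entropy {α : Type*} [Fintype α] (p : PMF α) : ℝ :=
  ∑ a, Real.negMulLog (p a).toReal / Real.log 2

/-- Mutual information `I(X;Y) = H(X) + H(Y) - H(X,Y)` of a pair with joint law `p`. -/
def mutualInformation {α β : Type*} [Fintype α] [Fintype β] (p : PMF (α × β)) : ℝ :=
  entropy (p.map Prod.fst) + entropy (p.map Prod.snd) - entropy p

/-- Probability of an event under the uniform law on the finite type `Ω`. -/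
def uniformProb {Ω : Type*} (E : Ω → Prop) : ℝ :=
  (Nat.card {ω : Ω // E ω} : ℝ) / (Nat.card Ω : ℝ)

/-! ### Placement of the files -/

/-- The library: `N` files of `F` bits each. -/
abbrev Library (N F : ℕ) : Type := Fin N → Fin F → Bool

/-- A demand vector: user `k` requests file `d k`. -/
abbrev Demand (K N : ℕ) : Type := Fin K → Fin N

/-- A data placement: user `k` caches the set `Z k n` of `b` bit positions of file `n`.
The uniform law on this type makes the sets `Z k n` independent and uniform. -/
abbrev Placement (K N F b : ℕ) : Type :=
  Fin K → Fin N → {A : Finset (Fin F) // A.card = b}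

/-- The fragment `W_{n,τ}`: the bit positions of file `n` cached exactly by the users in `τ`. -/
def fragment {K N F b : ℕ} (Z : Placement K N F b) (n : Fin N) (τ : Finset (Fin K)) :
    Finset (Fin F) :=
  Finset.univ.filter fun i => ∀ k, i ∈ (Z k n).1 ↔ k ∈ τ

/-- The size `min (s + L - 1, K)` of the groups of users served in round `s`. -/
def groupSize (K L s : ℕ) : ℕ := min (s + L - 1) K

/-- The number of groups `S` in round `s` containing a given `s`-subset `U`, that is, the number
of mini-files into which each fragment `W_{n,τ}` with `|τ| = s - 1` is split. -/
def miniCount (K L s : ℕ) : ℕ := (K - s).choose (groupSize K L s - s)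

/-- The length, in `m`-bit symbols, of the mini-files of `W_{n,τ}` (rounded up). -/
def miniLength {K N F b : ℕ} (m L : ℕ) (Z : Placement K N F b) (n : Fin N)
    (τ : Finset (Fin K)) : ℕ :=
  (fragment Z n τ).card ⌈/⌉ (m * miniCount K L (τ.card + 1))

/-- The `p`-th symbol of the fragment `W_{n,τ}`: its bits are listed in increasing order, cut into
strings of `m` bits (the last one padded by zero bits), and read as field elements by `repr`. -/
def fragmentSymbol {K N F b m : ℕ} {𝔽 : Type} (repr : (Fin m → Bool) ≃ 𝔽) (W : Library N F)
    (Z : Placement K N F b) (n : Fin N) (τ : Finset (Fin K)) (p : ℕ) : 𝔽 :=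
  repr fun i =>
    if h : p * m + i < (fragment Z n τ).card then
      W n ((fragment Z n τ).orderEmbOfFin rfl ⟨p * m + i, h⟩)
    else false

/-- Symbol `t` of the mini-file `W_{n,τ}^c`, padded by zeros beyond its length. -/
def miniFile {K N F b m : ℕ} {𝔽 : Type} [Field 𝔽] (L : ℕ) (repr : (Fin m → Bool) ≃ 𝔽)
    (W : Library N F) (Z : Placement K N F b) (n : Fin N) (τ : Finset (Fin K)) (c t : ℕ) : 𝔽 :=
  if t < miniLength m L Z n τ then
    fragmentSymbol repr W Z n τ (c * miniLength m L Z n τ + t)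
  else 0

/-- The running counter that selects a fresh mini-file: the number of groups `S'` of the same size
containing `U` that are processed before `S` (groups are processed in colexicographic order). -/
def freshIndex {K : ℕ} (S U : Finset (Fin K)) : ℕ :=
  ((Finset.powersetCard S.card (Finset.univ : Finset (Fin K))).filter fun S' =>
    U ⊆ S' ∧ toColex S' < toColex S).card

/-! ### Coded messages and keys -/

/-- The index of a coded message `x_ω(S)` of round `s`: a round `s ∈ {1, …, K}`, a group `S` with
`|S| = min (s + L - 1, K)`, and a repetition index `ω` among `(|S| - 1).choose (s - 1)`. -/
abbrev Message (K L : ℕ) : Type :=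
  Σ s : Finset.Icc 1 K,
    (Finset.powersetCard (groupSize K L s) (Finset.univ : Finset (Fin K))) ×
      Fin ((groupSize K L s - 1).choose (s - 1))

/-- The round of a message. -/
def Message.round {K L : ℕ} (μ : Message K L) : ℕ := μ.1

/-- The group of users served by a message. -/
def Message.group {K L : ℕ} (μ : Message K L) : Finset (Fin K) := μ.2.1

/-- The number of symbols (time slots) of a message under demand `d`: the length of the longest
mini-file that it has to carry. -/
def blockLength {K L N F b : ℕ} (m : ℕ) (Z : Placement K N F b) (d : Demand K N)
    (μ : Message K L) : ℕ :=
  (Finset.powersetCard μ.round μ.group).sup fun U =>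
    U.sup fun r => miniLength m L Z (d r) (U.erase r)

/-- The number of symbols of the key of a message. Keys are placed before the demands are known,
so a key is as long as the longest block that some demand requires. -/
def keyLength {K L N F b : ℕ} (m : ℕ) (Z : Placement K N F b) (μ : Message K L) : ℕ :=
  Finset.univ.sup fun d : Demand K N => blockLength m Z d μ

theorem blockLength_le_keyLength {K L N F b : ℕ} (m : ℕ) (Z : Placement K N F b)
    (d : Demand K N) (μ : Message K L) : blockLength m Z d μ ≤ keyLength m Z μ :=
  Finset.le_sup (f := fun d : Demand K N => blockLength m Z d μ) (Finset.mem_univ d)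

/-- The collection of all keys, one for each message. -/
abbrev Keys {K N F b : ℕ} (L m : ℕ) (𝔽 : Type) (Z : Placement K N F b) : Type :=
  (μ : Message K L) → Fin (keyLength m Z μ) → 𝔽

/-- The time slots of the delivery phase under demand `d`. -/
abbrev Slot {K N F b : ℕ} (L m : ℕ) (Z : Placement K N F b) (d : Demand K N) : Type :=
  Σ μ : Message K L, Fin (blockLength m Z d μ)

/-- The coefficients of the random linear combinations: `φ μ U r` multiplies, in the message `μ`,
the mini-file meant for user `r` in the combination for the subset `U`. -/
abbrev Coefficients (K L : ℕ) (𝔽 : Type) : Type :=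
  Message K L → Finset (Fin K) → Fin K → 𝔽

/-- Zero forcing: for a group `S` of round `s` and `U ⊆ S` with `|U| = s`, the beamforming vector
`u S U` is orthogonal to the channel of `j ∈ S \ U`, and not orthogonal to that of `j ∈ U`. -/
def ZeroForcing {K L : ℕ} {𝔽 : Type} [Field 𝔽] (H : Matrix (Fin K) (Fin L) 𝔽)
    (u : Finset (Fin K) → Finset (Fin K) → Fin L → 𝔽) : Prop :=
  ∀ s ∈ Finset.Icc 1 K, ∀ S : Finset (Fin K), S.card = groupSize K L s →
    ∀ U ⊆ S, U.card = s →
      (∀ j ∈ S \ U, H j ⬝ᵥ u S U = 0) ∧ ∀ j ∈ U, H j ⬝ᵥ u S U ≠ 0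

/-- The linear combination `G_ω(U)` of the mini-files wanted by the users `r ∈ U` and cached by
all the other users of `U`, at symbol `t`. -/
def combination {K L N F b m : ℕ} {𝔽 : Type} [Field 𝔽] (repr : (Fin m → Bool) ≃ 𝔽)
    (Z : Placement K N F b) (φ : Coefficients K L 𝔽) (d : Demand K N) (W : Library N F)
    (μ : Message K L) (U : Finset (Fin K)) (t : ℕ) : 𝔽 :=
  ∑ r ∈ U, φ μ U r * miniFile L repr W Z (d r) (U.erase r) (freshIndex μ.group U) t

/-- The vector `∑_U G_ω(U) u_S^U + K_S^{(ω)} 𝟙` sent by the `L` transmitters in a time slot. -/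
def transmit {K L N F b m : ℕ} {𝔽 : Type} [Field 𝔽] (repr : (Fin m → Bool) ≃ 𝔽)
    (Z : Placement K N F b) (φ : Coefficients K L 𝔽)
    (u : Finset (Fin K) → Finset (Fin K) → Fin L → 𝔽) (d : Demand K N) (W : Library N F)
    (κ : Keys L m 𝔽 Z) (a : Slot L m Z d) : Fin L → 𝔽 :=
  (∑ U ∈ Finset.powersetCard a.1.round a.1.group,
      combination repr Z φ d W a.1 U a.2 • u a.1.group U) +
    κ a.1 (Fin.castLE (blockLength_le_keyLength m Z d a.1) a.2) • (1 : Fin L → 𝔽)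

/-! ### Receivers -/

/-- The signal observed through a channel vector `h` during the whole delivery phase. -/
def received {L : ℕ} {𝔽 σ : Type} [Field 𝔽] (h : Fin L → 𝔽) (x : σ → Fin L → 𝔽) : σ → 𝔽 :=
  fun a => h ⬝ᵥ x a

/-- The file bits in the cache of user `k`. -/
def cachedData {K N F b : ℕ} (Z : Placement K N F b) (W : Library N F) (k : Fin K) :
    (n : Fin N) → (Z k n).1 → Bool :=
  fun n i => W n i

/-- The keys in the cache of user `k`: those of the messages whose group contains `k`. -/
def cachedKeys {K L N F b m : ℕ} {𝔽 : Type} {Z : Placement K N F b} (κ : Keys L m 𝔽 Z)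
    (k : Fin K) : (μ : {μ : Message K L // k ∈ μ.group}) → Fin (keyLength m Z μ.1) → 𝔽 :=
  fun μ => κ μ.1

/-- User `k` recovers its file without error from its received signal and its cache, whatever the
files and the keys are. -/
def Decodable {K L N F b m : ℕ} {𝔽 : Type} [Field 𝔽] (repr : (Fin m → Bool) ≃ 𝔽)
    (Z : Placement K N F b) (H : Matrix (Fin K) (Fin L) 𝔽) (φ : Coefficients K L 𝔽)
    (u : Finset (Fin K) → Finset (Fin K) → Fin L → 𝔽) (d : Demand K N) (k : Fin K) : Prop :=
  ∃ decode : (Slot L m Z d → 𝔽) → ((n : Fin N) → (Z k n).1 → Bool) →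
      ((μ : {μ : Message K L // k ∈ μ.group}) → Fin (keyLength m Z μ.1) → 𝔽) →
      (Fin F → Bool),
    ∀ (W : Library N F) (κ : Keys L m 𝔽 Z),
      decode (received (H k) (transmit repr Z φ u d W κ)) (cachedData Z W k) (cachedKeys κ k) =
        W (d k)

/-- The joint law of the library and of the signal of an eavesdropper with channel `h`, when the
library has law `P` and the keys are uniform and independent of it. -/
def eavesdropperLaw {K L N F b m : ℕ} {𝔽 : Type} [Field 𝔽] [Fintype 𝔽]
    (repr : (Fin m → Bool) ≃ 𝔽) (Z : Placement K N F b) (h : Fin L → 𝔽)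
    (φ : Coefficients K L 𝔽) (u : Finset (Fin K) → Finset (Fin K) → Fin L → 𝔽)
    (d : Demand K N) (P : PMF (Library N F)) :
    PMF ((Slot L m Z d → 𝔽) × Library N F) :=
  P.bind fun W => (PMF.uniformOfFintype (Keys L m 𝔽 Z)).map fun κ =>
    (received h (transmit repr Z φ u d W κ), W)

/-! ### Performance -/

/-- The number of time slots needed in the worst case over all demand vectors. -/
def worstCaseSlots {K N F b : ℕ} (L m : ℕ) (Z : Placement K N F b) : ℕ :=
  Finset.univ.sup fun d : Demand K N => Fintype.card (Slot L m Z d)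

/-- The number of file bits stored by user `k`. -/
def dataBits {K N F b : ℕ} (Z : Placement K N F b) (k : Fin K) : ℕ :=
  ∑ n, (Z k n).1.card

/-- The number of key bits stored by user `k` (a symbol has `m` bits). -/
def keyBits {K N F b : ℕ} (L m : ℕ) (Z : Placement K N F b) (k : Fin K) : ℕ :=
  m * ∑ μ : {μ : Message K L // k ∈ μ.group}, keyLength m Z μ.1

/-- A realization of everything that is random apart from files and keys: the data placement, the
channel matrix of the users, the channel vector of the eavesdropper, and the coefficients. -/
abbrev Realization (K L N F b : ℕ) (𝔽 : Type) : Type :=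
  Placement K N F b × Matrix (Fin K) (Fin L) 𝔽 × (Fin L → 𝔽) × Coefficients K L 𝔽

end SecureCaching

end

noncomputable section

namespace SecureCaching

section

open Finset

/-! ### Uniform probability -/

section UniformProb

variable {Ω Ω' : Type*}

/-! Four events of high probability make every assertion deterministic: (a) any at most `L` user
channels are linearly independent; (b) `h_e · 1 ≠ 0`; (c) for each group `S` and each `k ∈ S`, the
square matrix of coefficients `φ` at user `k`, with rows `ω` and columns `U ∋ k`, is invertible; (d)
every fragment `W_{n,τ}` has relative size within `η` of `q^|τ| (1-q)^(K-|τ|)`. Events (a)-(c)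
concern boundedly many uniform matrices over a field with `2^m` elements, so they fail with
probability `O(2^(-m))`. Event (d) follows from Chebyshev's inequality, since memberships of
distinct positions in a random set of fixed size are negatively correlated.

Beamforming: `|S \ U| ≤ L - 1`, so by (a) the vectors orthogonal to the channels of `S \ U` form a
space on which no `h_j`, `j ∈ U`, vanishes identically; a large field allows avoiding all these
hyperplanes at once (`exists_zeroForcing`).

Decoding: user `k` removes the key, zero forcing removes the sets `U ∌ k`, and the cache removes all
but one mini-file from each `U ∋ k`. The repetitions `ω` give as many equations as unknowns,
solvable by (c) (`miniFile_eq_of_received_eq`). The counter `freshIndex` runs through all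
mini-files, so the whole file is recovered (`decodable`).

Secrecy: by (b) the key is a one-time pad in each slot, so the signal is uniform whatever the files
are (`map_received_uniformOfFintype`).

Rates: by (d) the length of a block is nearly the same for all demands, so taking the worst demand
costs nothing in the limit; summing over blocks gives `T` and `M_K`. -/

theorem uniformProb_mono [Finite Ω] {E E' : Ω → Prop} (h : ∀ ω, E ω → E' ω) :
    uniformProb E ≤ uniformProb E' := by
  unfold uniformProb
  gcongr
  exact Nat.card_le_card_of_injective (fun x => ⟨x.1, h _ x.2⟩) fun x y hxy => by
    simpa [Subtype.ext_iff] using hxy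

theorem uniformProb_not [Finite Ω] [Nonempty Ω] (E : Ω → Prop) :
    uniformProb (fun ω => ¬ E ω) = 1 - uniformProb E := by
  classical
  have := Fintype.ofFinite Ω
  have h : (Fintype.card Ω : ℝ) ≠ 0 := by positivity
  have := Fintype.card_subtype_compl E
  have hle := Fintype.card_subtype_le E
  simp only [uniformProb, Nat.card_eq_fintype_card]
  rw [this, Nat.cast_sub hle]
  field_simp

theorem uniformProb_or_le [Finite Ω] (E E' : Ω → Prop) :
    uniformProb (fun ω => E ω ∨ E' ω) ≤ uniformProb E + uniformProb E' := by
  classical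
  have := Fintype.ofFinite Ω
  simp only [uniformProb, Nat.card_eq_fintype_card, ← add_div]
  gcongr
  exact_mod_cast Fintype.card_subtype_or E E'

theorem uniformProb_exists_le {ι : Type*} [Finite Ω] (s : Finset ι) (E : ι → Ω → Prop) :
    uniformProb (fun ω => ∃ i ∈ s, E i ω) ≤ ∑ i ∈ s, uniformProb (E i) := by
  classical
  induction s using Finset.induction_on with
  | empty => simp [uniformProb]
  | insert i s hi ih =>
    rw [Finset.sum_insert hi]
    simp only [Finset.exists_mem_insert]
    exact (uniformProb_or_le _ _).trans (by gcongr)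

theorem uniformProb_exists_le_card_mul {ι : Type*} [Fintype ι] [Finite Ω] (E : ι → Ω → Prop)
    {c : ℝ} (hE : ∀ i, uniformProb (E i) ≤ c) :
    uniformProb (fun ω => ∃ i, E i ω) ≤ Fintype.card ι * c := by
  have := uniformProb_exists_le Finset.univ E
  simp only [Finset.mem_univ, true_and] at this
  exact this.trans ((Finset.sum_le_sum fun i _ => hE i).trans (by simp))

/-- A map all of whose fibres have the same size transports the uniform law to the uniform law. -/
theorem uniformProb_comp_of_card_fiber [Finite Ω] [Finite Ω'] (f : Ω → Ω') {c : ℕ}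
    (hc : c ≠ 0) (hf : ∀ y, Nat.card {ω // f ω = y} = c) (E : Ω' → Prop) :
    uniformProb (fun ω => E (f ω)) = uniformProb E := by
  have := Fintype.ofFinite Ω
  have := Fintype.ofFinite Ω'
  have key : ∀ E : Ω' → Prop, Nat.card {ω // E (f ω)} = Nat.card {y // E y} * c := by
    intro E
    let e : {ω // E (f ω)} ≃ Σ y : {y // E y}, {ω // f ω = y} :=
      { toFun := fun ω => ⟨⟨f ω, ω.2⟩, ω.1, rfl⟩
        invFun := fun p => ⟨p.2.1, by rw [p.2.2]; exact p.1.2⟩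
        left_inv := fun _ => rfl
        right_inv := by
          rintro ⟨⟨y, hy⟩, ω, h⟩
          change f ω = y at h
          subst h
          rfl }
    have := Fintype.ofFinite {y // E y}
    rw [Nat.card_congr e, Nat.card_sigma]
    simp [hf]
  have h1 := key fun _ => True
  rw [Nat.card_congr (Equiv.subtypeUnivEquiv fun _ => trivial),
    Nat.card_congr (Equiv.subtypeUnivEquiv fun _ => trivial)] at h1
  have : (c : ℝ) ≠ 0 := by exact_mod_cast hc
  rw [uniformProb, uniformProb, key, h1]
  push_cast
  rw [mul_div_mul_right _ _ this]

theorem uniformProb_comp_fst {A B : Type*} [Finite A] [Finite B] [Nonempty B] (E : A → Prop) :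
    uniformProb (fun ω : A × B => E ω.1) = uniformProb E := by
  refine uniformProb_comp_of_card_fiber Prod.fst (c := Nat.card B) Nat.card_pos.ne' ?_ E
  intro y
  exact Nat.card_congr
    { toFun := fun p => p.1.2
      invFun := fun b => ⟨(y, b), rfl⟩
      left_inv := by rintro ⟨⟨a, b⟩, rfl⟩; rfl
      right_inv := fun _ => rfl }

theorem uniformProb_comp_equiv [Finite Ω] [Finite Ω'] (e : Ω ≃ Ω') (E : Ω' → Prop) :
    uniformProb (fun ω => E (e ω)) = uniformProb E := by
  refine uniformProb_comp_of_card_fiber e one_ne_zero (fun y => ?_) E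
  rw [Nat.card_congr (Equiv.subtypeEquivRight (q := fun ω => ω = e.symm y) fun ω =>
    e.eq_symm_apply.symm)]
  simp

theorem uniformProb_comp_snd {A B : Type*} [Finite A] [Finite B] [Nonempty A] (E : B → Prop) :
    uniformProb (fun ω : A × B => E ω.2) = uniformProb E :=
  (uniformProb_comp_equiv (Equiv.prodComm A B) fun p => E p.1).trans (uniformProb_comp_fst E)

theorem card_fiber_of_surjective {G G' : Type*} [AddGroup G] [AddGroup G'] (f : G →+ G')
    (hf : Function.Surjective f) (y : G') :
    Nat.card {g // f g = y} = Nat.card f.ker := by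
  obtain ⟨g₀, rfl⟩ := hf y
  exact Nat.card_congr
    { toFun := fun g => ⟨g.1 - g₀, by simp [AddMonoidHom.mem_ker, g.2]⟩
      invFun := fun g => ⟨g.1 + g₀, by simp [(AddMonoidHom.mem_ker).1 g.2]⟩
      left_inv := fun g => by simp
      right_inv := fun g => by simp }

theorem uniformProb_comp_addMonoidHom {G G' : Type*} [AddGroup G] [AddGroup G'] [Finite G]
    [Finite G'] (f : G →+ G') (hf : Function.Surjective f) (E : G' → Prop) :
    uniformProb (fun ω => E (f ω)) = uniformProb E :=
  uniformProb_comp_of_card_fiber f Nat.card_pos.ne' (card_fiber_of_surjective f hf) E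

/-- Chebyshev's inequality for the uniform law. -/
theorem uniformProb_abs_ge_le [Fintype Ω] (X : Ω → ℝ) {t v : ℝ} (ht : 0 < t)
    (hv : ∑ ω, X ω ^ 2 ≤ v * Fintype.card Ω) (hv0 : 0 ≤ v) :
    uniformProb (fun ω => t ≤ |X ω|) ≤ v / t ^ 2 := by
  classical
  rw [uniformProb, Nat.card_eq_fintype_card, Nat.card_eq_fintype_card, Fintype.card_subtype]
  have h : (#{ω : Ω | t ≤ |X ω|} : ℝ) * t ^ 2 ≤ v * Fintype.card Ω := by
    refine le_trans ?_ hv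
    rw [← nsmul_eq_mul, ← Finset.sum_const]
    refine (Finset.sum_le_sum fun ω hω => ?_).trans
      (Finset.sum_le_sum_of_subset_of_nonneg (Finset.subset_univ _) fun _ _ _ => sq_nonneg _)
    rw [← sq_abs (X ω)]
    have := (Finset.mem_filter.1 hω).2
    gcongr
  refine div_le_of_le_mul₀ (by positivity) (by positivity) ?_
  rw [div_mul_eq_mul_div, le_div_iff₀ (by positivity)]
  exact h

end UniformProb

end

section

open Finset

/-! ### Generic vectors over a finite field -/

/-- Independence puts `H j` outside the span of the other vectors, so a linear functional separates
it from that span; every functional on `Fin L → 𝔽` is a dot product. -/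
theorem exists_dotProduct_eq_zero_ne_zero {𝔽 : Type*} [Field 𝔽] {ι : Type*} {L : ℕ} [DecidableEq ι]
    (H : ι → Fin L → 𝔽) (A : Finset ι) (j : ι) (hj : j ∉ A)
    (hli : LinearIndepOn 𝔽 H (insert j A : Finset ι)) :
    ∃ v : Fin L → 𝔽, (∀ i ∈ A, H i ⬝ᵥ v = 0) ∧ H j ⬝ᵥ v ≠ 0 := by
  rw [Finset.coe_insert, linearIndepOn_insert (by simpa using hj)] at hli
  obtain ⟨f, hf, hfp⟩ := Submodule.exists_le_ker_of_notMem hli.2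
  have key : ∀ x, x ⬝ᵥ (dotProductEquiv 𝔽 (Fin L)).symm f = f x := by
    intro x
    rw [dotProduct_comm]
    exact LinearMap.congr_fun ((dotProductEquiv 𝔽 (Fin L)).apply_symm_apply f) x
  refine ⟨(dotProductEquiv 𝔽 (Fin L)).symm f, fun i hi => ?_, ?_⟩
  · rw [key]
    exact hfp (Submodule.subset_span ⟨i, hi, rfl⟩)
  · rw [key]
    exact hf

section Generic

variable {𝔽 : Type*} [Field 𝔽] [Fintype 𝔽]

/-- With `Q = |𝔽|`, the proportion of independent families is `∏ (1 - Q^(i-n))`, where each factor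
is at least `1 - 1/Q`; Bernoulli's inequality concludes. -/
theorem uniformProb_not_linearIndependent_le {V : Type*} [AddCommGroup V] [Module 𝔽 V] [Finite V]
    {k : ℕ} (hk : k ≤ Module.finrank 𝔽 V) :
    uniformProb (fun v : Fin k → V => ¬ LinearIndependent 𝔽 v) ≤ k / Fintype.card 𝔽 := by
  set n := Module.finrank 𝔽 V
  set Q := Fintype.card 𝔽
  have hQ : 1 ≤ Q := Fintype.card_pos
  have hQ0 : (0 : ℝ) < Q := by exact_mod_cast hQ
  have hQ1 : (1 : ℝ) ≤ Q := by exact_mod_cast hQ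
  have hV : Nat.card V = Q ^ n := by
    have := Fintype.ofFinite V
    rw [Nat.card_eq_fintype_card]
    exact Module.card_eq_pow_finrank
  rw [uniformProb_not, uniformProb, card_linearIndependent hk, Nat.card_fun, hV]
  have hin : ∀ i : Fin k, (i : ℕ) < n := fun i => i.2.trans_le hk
  have h1 : ∀ i : Fin k, ((Q : ℝ) ^ n - (Q : ℝ) ^ (i : ℕ)) / (Q : ℝ) ^ n ≥ 1 - 1 / Q := by
    intro i
    rw [sub_div, div_self (by positivity), ge_iff_le, sub_le_sub_iff_left,
      div_le_div_iff₀ (by positivity) hQ0, one_mul, ← pow_succ]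
    exact pow_le_pow_right₀ hQ1 (hin i)
  have h2 : (((∏ i : Fin k, (Q ^ n - Q ^ (i : ℕ)) : ℕ) : ℝ) / ((Q ^ n) ^ Nat.card (Fin k) : ℕ)) =
      ∏ i : Fin k, (((Q : ℝ) ^ n - (Q : ℝ) ^ (i : ℕ)) / (Q : ℝ) ^ n) := by
    rw [Finset.prod_div_distrib]
    push_cast [Nat.cast_sub (Nat.pow_le_pow_right hQ (hin _).le)]
    simp
  rw [h2]
  have h0 : (0 : ℝ) ≤ 1 - 1 / Q := by
    rw [sub_nonneg, div_le_one hQ0]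
    exact hQ1
  have h3 : (1 - 1 / (Q : ℝ)) ^ k ≤
      ∏ i : Fin k, (((Q : ℝ) ^ n - (Q : ℝ) ^ (i : ℕ)) / (Q : ℝ) ^ n) := by
    calc (1 - 1 / (Q : ℝ)) ^ k = ∏ _i : Fin k, (1 - 1 / (Q : ℝ)) := by simp
      _ ≤ _ := Finset.prod_le_prod (fun _ _ => h0) fun i _ => h1 i
  have h4 : 1 - k / (Q : ℝ) ≤ (1 - 1 / (Q : ℝ)) ^ k := by
    have := one_add_mul_le_pow (a := -(1 / (Q : ℝ))) (by linarith) k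
    calc 1 - k / (Q : ℝ) = 1 + k * -(1 / (Q : ℝ)) := by ring
      _ ≤ _ := this
      _ = _ := by ring
  linarith

theorem uniformProb_not_linearIndependent_comp_le {ι V : Type*} [Finite ι] [AddCommGroup V]
    [Module 𝔽 V] [Finite V] {k : ℕ} {e : Fin k → ι} (he : Function.Injective e)
    (hk : k ≤ Module.finrank 𝔽 V) :
    uniformProb (fun H : ι → V => ¬ LinearIndependent 𝔽 fun i => H (e i)) ≤
      k / Fintype.card 𝔽 := by
  let f : (ι → V) →+ (Fin k → V) :=
    { toFun := fun H i => H (e i)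
      map_zero' := rfl
      map_add' := fun _ _ => rfl }
  have hf : Function.Surjective f := fun v =>
    ⟨Function.extend e v 0, funext fun i => he.extend_apply v 0 i⟩
  exact (uniformProb_comp_addMonoidHom f hf fun v => ¬ LinearIndependent 𝔽 v).trans_le
    (uniformProb_not_linearIndependent_le hk)

/-- A subspace over a field is not covered by too few proper subspaces: along a line `v + c • w`,
each functional excludes at most one scalar `c`. -/
theorem exists_forall_apply_ne_zero {V ι : Type*} [AddCommGroup V] [Module 𝔽 V] (s : Finset ι)
    (l : ι → V →ₗ[𝔽] 𝔽) (hs : s.card < Fintype.card 𝔽) (p : Submodule 𝔽 V)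
    (h : ∀ i ∈ s, ∃ v ∈ p, l i v ≠ 0) : ∃ v ∈ p, ∀ i ∈ s, l i v ≠ 0 := by
  classical
  induction s using Finset.induction_on with
  | empty => exact ⟨0, p.zero_mem, by simp⟩
  | insert j s hj ih =>
    obtain ⟨v, hv, hvs⟩ := ih
      ((Finset.card_le_card (Finset.subset_insert j s)).trans_lt hs)
      fun i hi => h i (Finset.mem_insert_of_mem hi)
    obtain ⟨w, hw, hwj⟩ := h j (Finset.mem_insert_self j s)
    -- If `l i w = 0`, the quotient is `0` by convention; this excludes one harmless extra scalar
    -- and leaves the count unchanged.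
    have hcard : ((insert j s).image fun i => -(l i v) / l i w).card < Fintype.card 𝔽 :=
      Finset.card_image_le.trans_lt hs
    obtain ⟨c, hc⟩ : ∃ c, c ∉ (insert j s).image fun i => -(l i v) / l i w := by
      by_contra! hcon
      rw [Finset.eq_univ_of_forall hcon] at hcard
      exact lt_irrefl _ hcard
    refine ⟨v + c • w, p.add_mem hv (p.smul_mem c hw), fun i hi h0 => ?_⟩
    rw [map_add, map_smul, smul_eq_mul] at h0
    by_cases hiw : l i w = 0
    · rw [hiw, mul_zero, add_zero] at h0
      rcases Finset.mem_insert.1 hi with rfl | hi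
      · exact hwj hiw
      · exact hvs i hi h0
    · refine hc (Finset.mem_image.2 ⟨i, hi, ?_⟩)
      field_simp
      linear_combination -h0

end Generic

/-! ### Beamforming vectors -/

section Beamforming

variable {K L : ℕ} {𝔽 : Type} [Field 𝔽] [Fintype 𝔽]

/-- For `j ∈ U`, the set `(S \ U) ∪ {j}` has at most `L` elements, so its channels are independent
and `h_j` is not zero on the orthogonal space of `S \ U`. -/
theorem exists_zeroForcing (hL : 1 ≤ L) (H : Matrix (Fin K) (Fin L) 𝔽)
    (hQ : K < Fintype.card 𝔽)
    (hH : ∀ A : Finset (Fin K), A.card ≤ L → LinearIndepOn 𝔽 H (A : Set (Fin K))) :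
    ∃ u, ZeroForcing H u := by
  -- The conditions on `S` and `U` stand under the existential, so that `choose` yields a total
  -- function `u`.
  have key : ∀ S U : Finset (Fin K), ∃ v : Fin L → 𝔽, U ⊆ S → S.card - U.card + 1 ≤ L →
      (∀ j ∈ S \ U, H j ⬝ᵥ v = 0) ∧ ∀ j ∈ U, H j ⬝ᵥ v ≠ 0 := by
    intro S U
    by_cases h : U ⊆ S ∧ S.card - U.card + 1 ≤ L
    swap
    · exact ⟨0, fun h1 h2 => absurd ⟨h1, h2⟩ h⟩
    let p : Submodule 𝔽 (Fin L → 𝔽) :=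
      ⨅ j ∈ S \ U, LinearMap.ker (dotProductEquiv 𝔽 (Fin L) (H j))
    have hp : ∀ v, v ∈ p ↔ ∀ j ∈ S \ U, H j ⬝ᵥ v = 0 := by
      intro v
      simp [p, Submodule.mem_iInf]
    obtain ⟨v, hv, hvU⟩ := exists_forall_apply_ne_zero U
      (fun j => dotProductEquiv 𝔽 (Fin L) (H j))
      ((Finset.card_le_univ U).trans_lt (by simpa using hQ)) p (by
        intro j hj
        obtain ⟨v, hv⟩ := exists_dotProduct_eq_zero_ne_zero H (S \ U) j (by simp [hj])
          (hH _ ((Finset.card_insert_le _ _).trans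
            (by rw [Finset.card_sdiff_of_subset h.1]; exact h.2)))
        exact ⟨v, (hp v).2 hv.1, by simpa using hv.2⟩)
    exact ⟨v, fun _ _ => ⟨(hp v).1 hv, fun j hj => by simpa using hvU j hj⟩⟩
  choose u hu using key
  refine ⟨u, fun s hs S hS U hU hUs => hu S U hU ?_⟩
  have := Finset.mem_Icc.1 hs
  rw [hS, hUs, groupSize]
  omega

theorem uniformProb_exists_not_linearIndepOn_le :
    uniformProb (fun H : Matrix (Fin K) (Fin L) 𝔽 =>
      ∃ A : Finset (Fin K), ¬ (A.card ≤ L → LinearIndepOn 𝔽 H (A : Set (Fin K)))) ≤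
      Fintype.card (Finset (Fin K)) * (L / Fintype.card 𝔽 : ℝ) := by
  refine uniformProb_exists_le_card_mul _ fun A => ?_
  by_cases hA : A.card ≤ L
  swap
  · have h0 : uniformProb (fun H : Matrix (Fin K) (Fin L) 𝔽 =>
        ¬ (A.card ≤ L → LinearIndepOn 𝔽 H (A : Set (Fin K)))) = 0 := by
      simp [hA, uniformProb]
    rw [h0]
    positivity
  have he : Function.Injective fun i => (A.equivFin.symm i : Fin K) :=
    Subtype.val_injective.comp A.equivFin.symm.injective
  have h := uniformProb_not_linearIndependent_comp_le (𝔽 := 𝔽) (V := Fin L → 𝔽) he (by simpa using hA)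
  have h2 : (A.card / Fintype.card 𝔽 : ℝ) ≤ L / Fintype.card 𝔽 := by gcongr
  refine le_trans ?_ (h.trans h2)
  refine uniformProb_mono (Ω := Fin K → Fin L → 𝔽) fun H hH hli => hH fun _ => ?_
  exact (linearIndependent_equiv A.equivFin.symm).1 hli

/-- The image of `h` under `h ↦ h · 1` is uniform on `𝔽`, and a scalar vanishes exactly when it is
dependent as a one-element family. -/
theorem uniformProb_sum_eq_zero_le (hL : 1 ≤ L) :
    uniformProb (fun h : Fin L → 𝔽 => h ⬝ᵥ 1 = 0) ≤ 1 / Fintype.card 𝔽 := by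
  let f : (Fin L → 𝔽) →+ (Fin 1 → 𝔽) :=
    { toFun := fun h _ => h ⬝ᵥ 1
      map_zero' := by ext; simp
      map_add' := fun _ _ => by ext; simp }
  have hf : Function.Surjective f := by
    intro v
    refine ⟨Pi.single ⟨0, hL⟩ (v 0), funext fun i => ?_⟩
    simp [f, Subsingleton.elim i 0]
  have h := uniformProb_comp_addMonoidHom f hf fun v => ¬ LinearIndependent 𝔽 v
  have h2 := uniformProb_not_linearIndependent_le (𝔽 := 𝔽) (V := 𝔽) (k := 1) (by simp)
  rw [← h, Nat.cast_one] at h2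
  refine le_trans (uniformProb_mono fun x hx hli => ?_) h2
  exact hli.ne_zero 0 hx

end Beamforming

end

section

open Finset

/-! ### Generic coefficients -/

/-- Removing `k` is a bijection. Applied to a group, the count is the number of repetitions `ω`,
which makes the system of each user square. -/
theorem card_filter_mem_powersetCard {α : Type*} [DecidableEq α] {S : Finset α} {k : α}
    (hk : k ∈ S) {s : ℕ} (hs : 1 ≤ s) :
    ((powersetCard s S).filter fun U => k ∈ U).card = (S.card - 1).choose (s - 1) := by
  obtain ⟨s, rfl⟩ : ∃ r, s = r + 1 := ⟨s - 1, by omega⟩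
  rw [Nat.add_sub_cancel, ← Finset.card_erase_of_mem hk, ← Finset.card_powersetCard]
  refine Finset.card_nbij' (fun U => U.erase k) (insert k) ?_ ?_ ?_ ?_
  · intro U hU
    simp only [coe_filter, mem_powersetCard, Set.mem_ofPred_eq, mem_coe] at hU ⊢
    exact ⟨Finset.erase_subset_erase k hU.1.1, by rw [Finset.card_erase_of_mem hU.2, hU.1.2]; rfl⟩
  · intro U hU
    simp only [coe_filter, mem_powersetCard, Set.mem_ofPred_eq, mem_coe] at hU ⊢
    have hkU : k ∉ U := fun h => by simpa using hU.1 h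
    exact ⟨⟨Finset.insert_subset hk (hU.1.trans (Finset.erase_subset _ _)),
      by rw [Finset.card_insert_of_notMem hkU, hU.2]⟩, Finset.mem_insert_self _ _⟩
  · intro U hU
    exact Finset.insert_erase (Finset.mem_filter.1 hU).2
  · intro U hU
    exact Finset.erase_insert fun h => by simpa using (Finset.mem_powersetCard.1 hU).1 h

/-- The combinations that a user `k` has to invert in a group are linearly independent: for each
group `S ∋ k` of round `s`, the system in the unknowns `x U`, `k ∈ U ⊆ S`, `|U| = s`, has only
the trivial solution. -/
def GenericCoefficients {K L : ℕ} {𝔽 : Type} [Field 𝔽] (φ : Coefficients K L 𝔽) : Prop :=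
  ∀ (s : Finset.Icc 1 K)
    (S : Finset.powersetCard (groupSize K L s) (Finset.univ : Finset (Fin K))) (k : Fin K),
    k ∈ S.1 → ∀ x : Finset (Fin K) → 𝔽,
    (∀ ω, ∑ U ∈ (powersetCard s S.1).filter (fun U => k ∈ U), φ ⟨s, S, ω⟩ U k * x U = 0) →
      ∀ U ∈ (powersetCard s S.1).filter (fun U => k ∈ U), x U = 0

theorem eq_zero_of_linearIndependent_rows {𝔽 α : Type*} [Field 𝔽] {n : ℕ} (A : Finset α)
    (e : Fin n ≃ A) (M : Fin n → α → 𝔽)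
    (hM : LinearIndependent 𝔽 fun i j : Fin n => M i (e j)) (x : α → 𝔽)
    (hx : ∀ i, ∑ a ∈ A, M i a * x a = 0) : ∀ a ∈ A, x a = 0 := by
  let M' : Matrix (Fin n) (Fin n) 𝔽 := Matrix.of fun i j => M i (e j)
  have hu : IsUnit M' := Matrix.linearIndependent_rows_iff_isUnit.1 hM
  have h0 : M'.mulVec (fun j => x (e j)) = 0 := by
    funext i
    rw [Pi.zero_apply, ← hx i, ← Finset.sum_coe_sort A, ← e.sum_comp]
    rfl
  have := Matrix.mulVec_injective_iff_isUnit.2 hu (h0.trans (Matrix.mulVec_zero _).symm)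
  intro a ha
  have h := congrFun this (e.symm ⟨a, ha⟩)
  simpa using h

/-- For fixed `s`, `S` and `k ∈ S`, the relevant coefficients are distinct coordinates of `φ`, hence
form a uniform square matrix; then a union bound over `(s, S, k)`. -/
theorem uniformProb_not_genericCoefficients_le (K L : ℕ) {𝔽 : Type} [Field 𝔽] [Fintype 𝔽] :
    uniformProb (fun φ : Coefficients K L 𝔽 => ¬ GenericCoefficients φ) ≤
      Fintype.card ((Σ s : Finset.Icc 1 K,
        Finset.powersetCard (groupSize K L s) (Finset.univ : Finset (Fin K))) × Fin K) *
        (2 ^ K / Fintype.card 𝔽 : ℝ) := by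
  have hmono : ∀ φ : Coefficients K L 𝔽, ¬ GenericCoefficients φ →
      ∃ p : (Σ s : Finset.Icc 1 K,
        Finset.powersetCard (groupSize K L s) (Finset.univ : Finset (Fin K))) × Fin K,
        ¬ (p.2 ∈ p.1.2.1 → ∀ x : Finset (Fin K) → 𝔽,
          (∀ ω, ∑ U ∈ (powersetCard p.1.1 p.1.2.1).filter (fun U => p.2 ∈ U),
            φ ⟨p.1.1, p.1.2, ω⟩ U p.2 * x U = 0) →
          ∀ U ∈ (powersetCard p.1.1 p.1.2.1).filter (fun U => p.2 ∈ U), x U = 0) := by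
    intro φ hφ
    by_contra! h
    exact hφ fun s S k => h (⟨s, S⟩, k)
  refine (uniformProb_mono hmono).trans (uniformProb_exists_le_card_mul _ ?_)
  rintro ⟨⟨s, S⟩, k⟩
  dsimp only
  by_cases hk : k ∈ S.1
  swap
  · have h0 : ∀ E : Coefficients K L 𝔽 → Prop, uniformProb (fun φ => ¬ (k ∈ S.1 → E φ)) = 0 := by
      intro E
      simp [hk, uniformProb]
    rw [h0]
    positivity
  set A := (powersetCard s S.1).filter (fun U => k ∈ U) with hA
  set n := (groupSize K L s - 1).choose (s - 1) with hn
  have hcard : A.card = n := by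
    rw [hA, card_filter_mem_powersetCard hk (Finset.mem_Icc.1 s.2).1,
      (Finset.mem_powersetCard.1 S.2).2]
  obtain ⟨e⟩ : Nonempty (Fin n ≃ A) := ⟨(A.equivFinOfCardEq hcard).symm⟩
  let f : Coefficients K L 𝔽 →+ (Fin n → Fin n → 𝔽) :=
    { toFun := fun φ i j => φ ⟨s, S, i⟩ (e j) k
      map_zero' := rfl
      map_add' := fun _ _ => rfl }
  have hf : Function.Surjective f := by
    intro v
    have h1 : Function.Injective fun i : Fin n => (⟨s, S, i⟩ : Message K L) := by
      intro i j hij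
      simpa using hij
    have h2 : Function.Injective fun j : Fin n => (e j : Finset (Fin K)) :=
      Subtype.val_injective.comp e.injective
    -- A preimage of the matrix `v`: zero at all other messages and subsets, constant in the user
    -- index.
    refine ⟨Function.extend (fun i : Fin n => (⟨s, S, i⟩ : Message K L))
      (fun i => Function.extend (fun j : Fin n => (e j : Finset (Fin K)))
        (fun j _ => v i j) 0) 0, ?_⟩
    funext i j
    have h3 := h1.extend_apply (fun i => Function.extend (fun j : Fin n => (e j : Finset (Fin K)))
        (fun j (_ : Fin K) => v i j) 0) 0 i
    have h4 := h2.extend_apply (fun j (_ : Fin K) => v i j) 0 j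
    exact congrFun ((congrFun h3 (e j)).trans h4) k
  have h := uniformProb_comp_addMonoidHom f hf fun v => ¬ LinearIndependent 𝔽 v
  have h2 := uniformProb_not_linearIndependent_le (𝔽 := 𝔽) (V := Fin n → 𝔽) (k := n) (by simp)
  have h3 : (n / Fintype.card 𝔽 : ℝ) ≤ 2 ^ K / Fintype.card 𝔽 := by
    gcongr
    have : n ≤ 2 ^ K := (Nat.choose_le_two_pow _ _).trans
      (Nat.pow_le_pow_right two_pos ((Nat.sub_le _ _).trans (min_le_right _ _)))
    exact_mod_cast this
  have h4 : ∀ φ : Coefficients K L 𝔽, LinearIndependent 𝔽 (f φ) → ∀ x : Finset (Fin K) → 𝔽,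
      (∀ ω, ∑ U ∈ A, φ ⟨s, S, ω⟩ U k * x U = 0) → ∀ U ∈ A, x U = 0 := fun φ hli x hx =>
    eq_zero_of_linearIndependent_rows A e (fun i U => φ ⟨s, S, i⟩ U k) hli x hx
  refine le_trans ?_ (h.trans_le (h2.trans h3))
  exact uniformProb_mono fun φ hφ hli => hφ fun _ => h4 φ hli

end

section

open Finset

/-! ### Decoding -/

theorem card_filter_subset_powersetCard {α : Type*} [DecidableEq α] {U V : Finset α}
    (hUV : U ⊆ V) {n : ℕ} (hn : U.card ≤ n) :
    ((powersetCard n V).filter fun S => U ⊆ S).card =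
      (V.card - U.card).choose (n - U.card) := by
  rw [← Finset.card_sdiff_of_subset hUV, ← Finset.card_powersetCard]
  refine Finset.card_nbij' (fun S => S \ U) (fun A => U ∪ A) ?_ ?_ ?_ ?_
  · intro S hS
    simp only [coe_filter, mem_powersetCard, Set.mem_ofPred_eq, mem_coe] at hS ⊢
    exact ⟨Finset.sdiff_subset_sdiff hS.1.1 subset_rfl,
      by rw [Finset.card_sdiff_of_subset hS.2, hS.1.2]⟩
  · intro A hA
    simp only [coe_filter, mem_powersetCard, Set.mem_ofPred_eq, mem_coe] at hA ⊢
    refine ⟨⟨Finset.union_subset hUV (hA.1.trans Finset.sdiff_subset), ?_⟩,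
      Finset.subset_union_left⟩
    rw [Finset.card_union_of_disjoint (Finset.disjoint_of_subset_right hA.1 Finset.disjoint_sdiff),
      hA.2]
    omega
  · intro S hS
    exact Finset.union_sdiff_of_subset (Finset.mem_filter.1 hS).2
  · intro A hA
    exact Finset.union_sdiff_cancel_left (Finset.disjoint_of_subset_right
      (Finset.mem_powersetCard.1 hA).1 Finset.disjoint_sdiff)

/-- The rank in `T` is injective on `T` with values below `T.card`, hence takes every such value. -/
theorem exists_card_filter_lt_eq {α : Type*} [LinearOrder α] (T : Finset α) {c : ℕ}
    (hc : c < T.card) : ∃ x ∈ T, (T.filter (· < x)).card = c := by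
  have hinj : Set.InjOn (fun x => (T.filter (· < x)).card) T := by
    have hlt : ∀ x ∈ T, ∀ y, x < y → (T.filter (· < x)).card < (T.filter (· < y)).card := by
      intro x hx y hxy
      refine Finset.card_lt_card (Finset.ssubset_iff_subset_ne.2 ⟨fun z hz => ?_, fun h => ?_⟩)
      · rw [Finset.mem_filter] at hz ⊢
        exact ⟨hz.1, hz.2.trans hxy⟩
      · have : x ∈ T.filter (· < x) := h ▸ Finset.mem_filter.2 ⟨hx, hxy⟩
        exact lt_irrefl _ (Finset.mem_filter.1 this).2
    intro x hx y hy hxy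
    rcases lt_trichotomy x y with h | h | h
    · exact absurd hxy (hlt x hx y h).ne
    · exact h
    · exact absurd hxy.symm (hlt y hy x h).ne
  have hmaps : Set.MapsTo (fun x => (T.filter (· < x)).card) T (range T.card) := by
    intro x hx
    simp only [coe_range, Set.mem_Iio]
    exact Finset.card_lt_card (Finset.filter_ssubset.2 ⟨x, hx, lt_irrefl x⟩)
  have := Finset.surjOn_of_injOn_of_card_le _ hmaps hinj (by simp)
  obtain ⟨x, hx, h⟩ := this (by simpa using hc : c ∈ (range T.card : Set ℕ))
  exact ⟨x, hx, h⟩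

theorem groupSize_le (K L s : ℕ) : groupSize K L s ≤ K := min_le_right _ _

theorem le_groupSize {K L s : ℕ} (hL : 1 ≤ L) (hs : s ≤ K) : s ≤ groupSize K L s :=
  le_min (by omega) hs

theorem miniCount_pos {K L s : ℕ} : 0 < miniCount K L s :=
  Nat.choose_pos (Nat.sub_le_sub_right (groupSize_le K L s) s)

/-- `freshIndex S U` is the colexicographic rank of `S` among the groups containing `U`, and there
are `miniCount` of these. Thus no mini-file is left unsent. -/
theorem exists_freshIndex_eq {K L c : ℕ} (hL : 1 ≤ L) (U : Finset (Fin K))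
    (hc : c < miniCount K L U.card) :
    ∃ S : Finset (Fin K), S.card = groupSize K L U.card ∧ U ⊆ S ∧ freshIndex S U = c := by
  have hU : U.card ≤ K := by simpa using Finset.card_le_univ U
  set n := groupSize K L U.card with hn
  let T : Finset (Colex (Finset (Fin K))) :=
    ((powersetCard n (univ : Finset (Fin K))).filter fun S => U ⊆ S).map toColex.toEmbedding
  have hT : T.card = miniCount K L U.card := by
    rw [Finset.card_map, card_filter_subset_powersetCard (Finset.subset_univ U)
      (le_groupSize hL hU), Finset.card_fin, miniCount]
  obtain ⟨x, hx, hxc⟩ := exists_card_filter_lt_eq T (hT ▸ hc)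
  obtain ⟨S, hS, rfl⟩ := Finset.mem_map.1 hx
  rw [Finset.mem_filter, Finset.mem_powersetCard] at hS
  refine ⟨S, hS.1.2, hS.2, ?_⟩
  rw [← hxc, freshIndex, Finset.filter_map, Finset.card_map, Finset.filter_filter, hS.1.2]
  rfl

/-! ### From mini-files back to bits -/

section Symbols

variable {K N F b m : ℕ} {𝔽 : Type} (repr : (Fin m → Bool) ≃ 𝔽) {W W' : Library N F}
  {Z : Placement K N F b} {n : Fin N} {τ : Finset (Fin K)}

theorem mem_fragment {i : Fin F} : i ∈ fragment Z n τ ↔ ∀ k, i ∈ (Z k n).1 ↔ k ∈ τ := by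
  simp [fragment]

theorem fragmentSymbol_congr (h : ∀ i ∈ fragment Z n τ, W n i = W' n i) (p : ℕ) :
    fragmentSymbol repr W Z n τ p = fragmentSymbol repr W' Z n τ p := by
  unfold fragmentSymbol
  congr 1
  funext i
  split_ifs with hi
  · exact h _ (Finset.orderEmbOfFin_mem _ _ _)
  · rfl

/-- The bit of rank `r` is bit `r % m` of symbol `r / m`, and `repr` is injective. -/
theorem eq_on_fragment_of_fragmentSymbol_eq {l : ℕ} (hl : (fragment Z n τ).card ≤ m * l)
    (h : ∀ p < l, fragmentSymbol repr W Z n τ p = fragmentSymbol repr W' Z n τ p) :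
    ∀ i ∈ fragment Z n τ, W n i = W' n i := by
  intro i hi
  obtain ⟨r, rfl⟩ : i ∈ Set.range ((fragment Z n τ).orderEmbOfFin rfl) := by
    rw [Finset.range_orderEmbOfFin]
    exact hi
  have hr := r.2.trans_le hl
  have hm : 0 < m := Nat.pos_of_ne_zero fun h0 => by simp [h0] at hr
  have h1 := congrFun (repr.injective (h (r / m) (Nat.div_lt_of_lt_mul hr)))
    ⟨r % m, Nat.mod_lt _ hm⟩
  simp only [Nat.div_add_mod', r.2, dif_pos] at h1
  exact h1

theorem eq_on_fragment_of_miniFile_eq [Field 𝔽] {L : ℕ} (hm : 1 ≤ m)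
    (h : ∀ c < miniCount K L (τ.card + 1), ∀ t < miniLength m L Z n τ,
      miniFile L repr W Z n τ c t = miniFile L repr W' Z n τ c t) :
    ∀ i ∈ fragment Z n τ, W n i = W' n i := by
  have hpos : 0 < m * miniCount K L (τ.card + 1) := Nat.mul_pos hm miniCount_pos
  refine eq_on_fragment_of_fragmentSymbol_eq repr
    (l := miniCount K L (τ.card + 1) * miniLength m L Z n τ) ?_ fun p hp => ?_
  · rw [← mul_assoc]
    have := le_smul_ceilDiv (b := (fragment Z n τ).card) hpos
    exact this
  · have hl : 0 < miniLength m L Z n τ := Nat.pos_of_ne_zero fun h0 => by simp [h0] at hp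
    have h1 := h (p / miniLength m L Z n τ) (Nat.div_lt_of_lt_mul (by rwa [mul_comm] at hp))
      (p % miniLength m L Z n τ) (Nat.mod_lt _ hl)
    simpa only [miniFile, if_pos (Nat.mod_lt _ hl), Nat.div_add_mod'] using h1

end Symbols

section Decoding

variable {K L N F b m : ℕ} {𝔽 : Type} [Field 𝔽] (repr : (Fin m → Bool) ≃ 𝔽)
  {Z : Placement K N F b} {H : Matrix (Fin K) (Fin L) 𝔽} {φ : Coefficients K L 𝔽}
  {u : Finset (Fin K) → Finset (Fin K) → Fin L → 𝔽} {d : Demand K N} {k : Fin K}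
  {W W' : Library N F} {κ κ' : Keys L m 𝔽 Z}

theorem received_transmit (h : Fin L → 𝔽) (a : Slot L m Z d) :
    received h (transmit repr Z φ u d W κ) a =
      (∑ U ∈ powersetCard a.1.round a.1.group,
        combination repr Z φ d W a.1 U a.2 * (h ⬝ᵥ u a.1.group U)) +
      κ a.1 (Fin.castLE (blockLength_le_keyLength m Z d a.1) a.2) * (h ⬝ᵥ 1) := by
  simp only [received, transmit, dotProduct_add, dotProduct_smul, dotProduct_sum, smul_eq_mul]

theorem eq_of_cachedData_eq (hZ : cachedData Z W k = cachedData Z W' k) {n : Fin N} {i : Fin F}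
    (hi : i ∈ (Z k n).1) : W n i = W' n i :=
  congrFun (congrFun hZ n) ⟨i, hi⟩

theorem miniFile_eq_of_cachedData_eq (hZ : cachedData Z W k = cachedData Z W' k) (n : Fin N)
    {τ : Finset (Fin K)} (hk : k ∈ τ) (c t : ℕ) :
    miniFile L repr W Z n τ c t = miniFile L repr W' Z n τ c t := by
  unfold miniFile
  rw [fragmentSymbol_congr repr fun i hi => eq_of_cachedData_eq hZ ((mem_fragment.1 hi k).2 hk)]

/-- Every term with `r ≠ k` involves a fragment cached by `k`, on which the two libraries agree. -/
theorem combination_sub (hZ : cachedData Z W k = cachedData Z W' k) (μ : Message K L)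
    {U : Finset (Fin K)} (hk : k ∈ U) (t : ℕ) :
    combination repr Z φ d W μ U t - combination repr Z φ d W' μ U t =
      φ μ U k * (miniFile L repr W Z (d k) (U.erase k) (freshIndex μ.group U) t -
        miniFile L repr W' Z (d k) (U.erase k) (freshIndex μ.group U) t) := by
  rw [combination, combination, ← Finset.sum_sub_distrib, Finset.sum_eq_single_of_mem k hk]
  · ring
  · intro r _ hrk
    rw [miniFile_eq_of_cachedData_eq repr hZ (d r) (Finset.mem_erase.2 ⟨hrk.symm, hk⟩), sub_self]

theorem miniLength_le_blockLength (μ : Message K L) {U : Finset (Fin K)}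
    (hU : U ∈ powersetCard μ.round μ.group) (hk : k ∈ U) :
    miniLength m L Z (d k) (U.erase k) ≤ blockLength m Z d μ :=
  (Finset.le_sup (f := fun r => miniLength m L Z (d r) (U.erase r)) hk).trans
    (Finset.le_sup (f := fun U => U.sup fun r => miniLength m L Z (d r) (U.erase r)) hU)

/-- Subtracting two equal observations cancels the keys and the cached mini-files, and zero forcing
cancels the sets `U ∌ k`. What remains is a homogeneous system, one equation per `ω`, with only the
trivial solution. -/
theorem miniFile_eq_of_received_eq (hu : ZeroForcing H u) (hφ : GenericCoefficients φ)
    (hy : received (H k) (transmit repr Z φ u d W κ) = received (H k) (transmit repr Z φ u d W' κ'))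
    (hZ : cachedData Z W k = cachedData Z W' k) (hκ : cachedKeys κ k = cachedKeys κ' k)
    (s : Finset.Icc 1 K)
    (S : Finset.powersetCard (groupSize K L s) (Finset.univ : Finset (Fin K)))
    {U : Finset (Fin K)} (hUS : U ⊆ S.1) (hUs : U.card = s) (hk : k ∈ U) {t : ℕ}
    (ht : t < miniLength m L Z (d k) (U.erase k)) :
    miniFile L repr W Z (d k) (U.erase k) (freshIndex S.1 U) t =
      miniFile L repr W' Z (d k) (U.erase k) (freshIndex S.1 U) t := by
  have hzf := hu s s.2 S.1 (Finset.mem_powersetCard.1 S.2).2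
  have hkS : k ∈ S.1 := hUS hk
  have hU : U ∈ powersetCard (s : ℕ) S.1 := Finset.mem_powersetCard.2 ⟨hUS, hUs⟩
  -- The unknowns absorb the gains `H k · u S U`, which are nonzero for `k ∈ U`.
  have key := hφ s S k hkS (fun U =>
    (miniFile L repr W Z (d k) (U.erase k) (freshIndex S.1 U) t -
      miniFile L repr W' Z (d k) (U.erase k) (freshIndex S.1 U) t) * (H k ⬝ᵥ u S.1 U)) ?_ U
    (Finset.mem_filter.2 ⟨hU, hk⟩)
  · exact sub_eq_zero.1 ((mul_eq_zero.1 key).resolve_right ((hzf U hUS hUs).2 k hk))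
  intro ω
  let μ : Message K L := ⟨s, S, ω⟩
  have htμ : t < blockLength m Z d μ := ht.trans_le (miniLength_le_blockLength μ hU hk)
  have h := congrFun hy ⟨μ, t, htμ⟩
  have hkey : κ μ = κ' μ := congrFun hκ ⟨μ, hkS⟩
  rw [received_transmit, received_transmit, hkey, add_left_inj, ← sub_eq_zero,
    ← Finset.sum_sub_distrib] at h
  rw [← h, Finset.sum_filter]
  refine Finset.sum_congr rfl fun V hV => ?_
  have hV' := Finset.mem_powersetCard.1 hV
  rw [← sub_mul]
  split_ifs with hkV
  · rw [combination_sub repr hZ μ hkV, mul_assoc]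
    rfl
  · have h0 : H k ⬝ᵥ u S.1 V = 0 := (hzf V hV'.1 hV'.2).1 k (Finset.mem_sdiff.2 ⟨hkS, hkV⟩)
    exact (mul_eq_zero_of_right _ h0).symm

/-- A decoder exists as soon as the observation determines the file. Each bit is either in the cache
of `k` or in a fragment `τ ∌ k`, whose mini-files are sent in the groups containing `insert k τ`. -/
theorem decodable (hm : 1 ≤ m) (hL : 1 ≤ L) (hu : ZeroForcing H u)
    (hφ : GenericCoefficients φ) (d : Demand K N) (k : Fin K) :
    Decodable repr Z H φ u d k := by
  let obs : Library N F × Keys L m 𝔽 Z → _ := fun p =>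
    (received (H k) (transmit repr Z φ u d p.1 p.2), cachedData Z p.1 k, cachedKeys p.2 k)
  have hfac : Function.FactorsThrough (fun p : Library N F × Keys L m 𝔽 Z => p.1 (d k)) obs := by
    rintro ⟨W, κ⟩ ⟨W', κ'⟩ h
    obtain ⟨hy, hZ, hκ⟩ : _ ∧ _ ∧ _ := by simpa only [obs, Prod.mk.injEq] using h
    funext i
    change W (d k) i = W' (d k) i
    set τ : Finset (Fin K) := univ.filter fun j => i ∈ (Z j (d k)).1 with hτ
    have hi : i ∈ fragment Z (d k) τ := mem_fragment.2 fun j => by simp [hτ]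
    by_cases hk : k ∈ τ
    · exact eq_of_cachedData_eq hZ (by simpa [hτ] using hk)
    refine eq_on_fragment_of_miniFile_eq repr (L := L) hm (fun c hc t ht => ?_) i hi
    have hcard := Finset.card_insert_of_notMem hk
    obtain ⟨S, hS, hUS, rfl⟩ := exists_freshIndex_eq hL (insert k τ) (hcard ▸ hc)
    have hsK : (insert k τ).card ∈ Finset.Icc 1 K :=
      Finset.mem_Icc.2 ⟨by omega, by simpa using Finset.card_le_univ (insert k τ)⟩
    have := miniFile_eq_of_received_eq repr hu hφ hy hZ hκ ⟨_, hsK⟩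
      ⟨S, Finset.mem_powersetCard.2 ⟨Finset.subset_univ S, hS⟩⟩ hUS rfl
      (Finset.mem_insert_self k τ) (t := t)
    rw [Finset.erase_insert hk] at this
    exact this ht
  -- The value of the decoder at impossible observations is irrelevant.
  refine ⟨fun y c q => Function.extend obs (fun p => p.1 (d k)) (fun _ _ => false) (y, c, q),
    fun W κ => ?_⟩
  exact hfac.extend_apply _ (W, κ)

end Decoding

end

section

open Finset

/-! ### Secrecy -/

theorem sum_toReal_eq_one {α : Type*} [Fintype α] (p : PMF α) : ∑ a, (p a).toReal = 1 := by
  have h := p.tsum_coe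
  rw [tsum_fintype] at h
  rw [← ENNReal.toReal_sum fun a _ => p.apply_ne_top a, h, ENNReal.toReal_one]

theorem entropy_of_apply_eq_mul {α β : Type*} [Fintype α] [Fintype β] (p : PMF (α × β))
    (u : PMF α) (v : PMF β) (h : ∀ a b, p (a, b) = u a * v b) :
    entropy p = entropy u + entropy v := by
  simp only [entropy, Fintype.sum_prod_type, h, ENNReal.toReal_mul, Real.negMulLog_mul, add_div,
    Finset.sum_add_distrib, mul_div_assoc]
  congr 1
  · simp only [← Finset.sum_mul, sum_toReal_eq_one, one_mul]
  · simp only [← Finset.mul_sum, ← Finset.sum_mul, sum_toReal_eq_one, one_mul]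

/-- As the conditional law of the signal is always `u`, the joint law is the product of `u` and `P`,
and entropy is additive on products. -/
theorem mutualInformation_bind_map {α β γ : Type*} [Fintype α] [Fintype β] (P : PMF β)
    (κ : PMF γ) (f : β → γ → α) (u : PMF α) (h : ∀ b, κ.map (f b) = u) :
    mutualInformation (P.bind fun b => κ.map fun c => (f b c, b)) = 0 := by
  classical
  have hmap : ∀ b, (κ.map fun c => (f b c, b)) = u.map fun a => (a, b) := fun b => by
    rw [← h b, PMF.map_comp]
    rfl
  simp only [hmap]
  have hfst : (P.bind fun b => u.map fun a => (a, b)).map Prod.fst = u := by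
    rw [PMF.map_bind]
    simp only [PMF.map_comp, Function.comp_def]
    exact (congrArg P.bind (funext fun _ => PMF.map_id u)).trans (PMF.bind_const P u)
  have hsnd : (P.bind fun b => u.map fun a => (a, b)).map Prod.snd = P := by
    rw [PMF.map_bind]
    simp only [PMF.map_comp, Function.comp_def]
    exact (congrArg P.bind (funext fun b => PMF.map_const u b)).trans (PMF.bind_pure P)
  rw [mutualInformation, hfst, hsnd, entropy_of_apply_eq_mul _ u P, sub_self]
  intro a b
  rw [PMF.bind_apply, tsum_eq_single b]
  · rw [PMF.map_apply, tsum_eq_single a, if_pos rfl, mul_comm]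
    intro a' ha'
    rw [if_neg]
    simpa using ha'.symm
  · intro b' hb'
    rw [PMF.map_apply, ENNReal.tsum_eq_zero.2, mul_zero]
    intro a'
    rw [if_neg]
    simp [hb'.symm]

theorem map_uniformOfFintype_of_card_fiber {α β : Type*} [Fintype α] [Nonempty α] [Fintype β]
    [Nonempty β] (f : α → β) {c : ℕ} (hc : ∀ y, Nat.card {a // f a = y} = c) :
    (PMF.uniformOfFintype α).map f = PMF.uniformOfFintype β := by
  classical
  have hα : Fintype.card α = Fintype.card β * c := by
    rw [← Nat.card_eq_fintype_card, ← Nat.card_congr (Equiv.sigmaFiberEquiv f), Nat.card_sigma]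
    simp only [hc, Finset.sum_const, Finset.card_univ, smul_eq_mul]
  have hc0 : c ≠ 0 := by
    rintro rfl
    exact Fintype.card_ne_zero (hα.trans (mul_zero _))
  ext y
  have hy : (univ.filter fun a => y = f a).card = c := by
    rw [← hc y, Nat.card_eq_fintype_card, Fintype.card_subtype]
    simp only [eq_comm]
  simp only [PMF.map_apply, PMF.uniformOfFintype_apply, tsum_fintype]
  rw [← Finset.sum_filter, Finset.sum_const, hy, hα, nsmul_eq_mul, Nat.cast_mul,
    ENNReal.mul_inv (Or.inr (by simp)) (Or.inl (by simp)), mul_left_comm,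
    ENNReal.mul_inv_cancel (by simpa using hc0) (by simp), mul_one]

section Secrecy

variable {K L N F b m : ℕ} {𝔽 : Type} [Field 𝔽] [Fintype 𝔽] (repr : (Fin m → Bool) ≃ 𝔽)
  {Z : Placement K N F b} {φ : Coefficients K L 𝔽}
  {u : Finset (Fin K) → Finset (Fin K) → Fin L → 𝔽} {h : Fin L → 𝔽}

/-- One-time pad: the signal is a translate, depending on the files, of a surjective homomorphic
image of the uniform keys. -/
theorem map_received_uniformOfFintype (hh : h ⬝ᵥ 1 ≠ 0) (d : Demand K N) (W : Library N F) :
    ((PMF.uniformOfFintype (Keys L m 𝔽 Z)).map fun κ =>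
      received h (transmit repr Z φ u d W κ)) =
      PMF.uniformOfFintype (Slot L m Z d → 𝔽) := by
  let g : Keys L m 𝔽 Z →+ (Slot L m Z d → 𝔽) :=
    { toFun := fun κ a =>
        κ a.1 (Fin.castLE (blockLength_le_keyLength m Z d a.1) a.2) * (h ⬝ᵥ 1)
      map_zero' := by funext a; simp
      map_add' := fun κ κ' => by funext a; simp [add_mul] }
  have hg : Function.Surjective g := by
    intro y
    -- A key may be longer than the block of this demand; its unused tail is set to zero.
    refine ⟨fun μ t => if ht : (t : ℕ) < blockLength m Z d μ then
      y ⟨μ, t, ht⟩ / (h ⬝ᵥ 1) else 0, ?_⟩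
    funext ⟨μ, t⟩
    simp [g, hh]
  let v : Slot L m Z d → 𝔽 := fun a => ∑ U ∈ powersetCard a.1.round a.1.group,
    combination repr Z φ d W a.1 U a.2 * (h ⬝ᵥ u a.1.group U)
  have hv : ∀ κ, received h (transmit repr Z φ u d W κ) = v + g κ := fun κ =>
    funext fun a => received_transmit repr h a
  refine map_uniformOfFintype_of_card_fiber _ (c := Nat.card g.ker) fun y => ?_
  rw [← card_fiber_of_surjective g hg (y - v)]
  refine Nat.card_congr (Equiv.subtypeEquivRight fun κ => ?_)
  rw [hv, eq_sub_iff_add_eq']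

theorem mutualInformation_eavesdropperLaw (hh : h ⬝ᵥ 1 ≠ 0) (d : Demand K N)
    (P : PMF (Library N F)) :
    mutualInformation (eavesdropperLaw repr Z h φ u d P) = 0 :=
  mutualInformation_bind_map P _ _ _ fun W => map_received_uniformOfFintype repr hh d W

end Secrecy

end

section

open Finset Filter Topology

/-! ### Concentration of the sizes of the fragments -/

/-! ### Correlations of membership in a uniform set of fixed size -/

section Subsets

variable {F b : ℕ}

theorem card_subtype_card_eq (F b : ℕ) :
    Fintype.card {A : Finset (Fin F) // A.card = b} = F.choose b := by
  rw [Fintype.card_finset_len, Fintype.card_fin]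

theorem sum_subtype_card_disjoint (U : Finset (Fin F)) :
    ∑ A : {A : Finset (Fin F) // A.card = b}, (if Disjoint A.1 U then (1 : ℝ) else 0) =
      ((F - U.card).choose b : ℝ) := by
  have hU : (univ \ U).card = F - U.card := by rw [Finset.card_univ_sdiff, Fintype.card_fin]
  rw [Finset.sum_boole, Nat.cast_inj, ← hU, ← Finset.card_powersetCard]
  refine Finset.card_bij (fun A _ => A.1) ?_ ?_ ?_
  · intro A hA
    rw [Finset.mem_powersetCard]
    refine ⟨fun i hi => ?_, A.2⟩
    simpa using Finset.disjoint_left.1 (Finset.mem_filter.1 hA).2 hi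
  · intro A _ B _ h
    exact Subtype.ext h
  · intro A hA
    rw [Finset.mem_powersetCard] at hA
    refine ⟨⟨A, hA.2⟩, Finset.mem_filter.2 ⟨Finset.mem_univ _, ?_⟩, rfl⟩
    exact Finset.disjoint_of_subset_left hA.1 Finset.sdiff_disjoint

/-- The fraction of the `b`-subsets of `Fin F` that contain, or that avoid, a given point. -/
def statusProb (F b : ℕ) (σ : Prop) [Decidable σ] : ℝ :=
  if σ then (b / F : ℝ) else 1 - b / F

theorem statusProb_nonneg (hb : b ≤ F) (σ : Prop) [Decidable σ] : 0 ≤ statusProb F b σ := by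
  have : (b / F : ℝ) ≤ 1 := div_le_one_of_le₀ (by exact_mod_cast hb) (by positivity)
  unfold statusProb
  split_ifs
  · positivity
  · linarith

theorem statusProb_le_one (hb : b ≤ F) (σ : Prop) [Decidable σ] : statusProb F b σ ≤ 1 := by
  have : (b / F : ℝ) ≤ 1 := div_le_one_of_le₀ (by exact_mod_cast hb) (by positivity)
  have : (0 : ℝ) ≤ b / F := by positivity
  unfold statusProb
  split_ifs <;> linarith

theorem sum_notMem (hb : b ≤ F) (i : Fin F) :
    ∑ A : {A : Finset (Fin F) // A.card = b}, (if i ∉ A.1 then (1 : ℝ) else 0) =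
      F.choose b * (1 - b / F) := by
  have h := sum_subtype_card_disjoint (b := b) {i}
  simp only [Finset.disjoint_singleton_right, Finset.card_singleton] at h
  rw [h]
  obtain ⟨n, rfl⟩ : ∃ n, F = n + 1 := ⟨F - 1, by have := i.2; omega⟩
  have h1 := congrArg (Nat.cast (R := ℝ)) (Nat.choose_mul_succ_eq n b)
  push_cast [Nat.cast_sub hb] at h1
  rw [Nat.add_sub_cancel]
  push_cast
  field_simp
  linarith

/-- Negative correlation of sampling without replacement: avoiding a second point has conditional
probability `1 - b/(F-1) ≤ 1 - b/F`. -/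
theorem sum_notMem_mul_notMem_le (hb : b ≤ F) {i j : Fin F} (hij : i ≠ j) :
    ∑ A : {A : Finset (Fin F) // A.card = b},
      (if i ∉ A.1 then (1 : ℝ) else 0) * (if j ∉ A.1 then (1 : ℝ) else 0) ≤
      F.choose b * (1 - b / F) ^ 2 := by
  have h := sum_subtype_card_disjoint (b := b) {j, i}
  have h0 := sum_subtype_card_disjoint (b := b) {i}
  have hc := sum_notMem hb i
  simp only [Finset.disjoint_singleton_right, Finset.disjoint_insert_right,
    Finset.card_singleton, Finset.card_pair hij.symm] at h h0
  simp only [mul_ite, mul_one, mul_zero, ← ite_and]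
  rw [h0] at hc
  rw [h]
  obtain ⟨n, rfl⟩ : ∃ n, F = n + 2 := ⟨F - 2, by
    have := i.2
    have := j.2
    have := Fin.val_ne_of_ne hij
    omega⟩
  rw [sq, ← mul_assoc, ← hc]
  rw [Nat.add_sub_cancel, show n + 2 - 1 = n + 1 from rfl]
  -- If `b ≥ F - 1`, no `b`-set avoids two points and the left side is zero.
  rcases Nat.lt_or_ge n b with hnb | hnb
  · rw [Nat.choose_eq_zero_of_lt hnb, Nat.cast_zero]
    have := statusProb_nonneg hb False
    simp only [statusProb, if_false] at this
    positivity
  · have h1 := congrArg (Nat.cast (R := ℝ)) (Nat.choose_mul_succ_eq n b)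
    push_cast [Nat.cast_sub (show b ≤ n + 1 by omega)] at h1
    have h2 : (n.choose b : ℝ) = (n + 1).choose b * (1 - b / (n + 1)) := by
      field_simp
      linarith
    rw [h2]
    push_cast
    gcongr
    linarith

theorem sum_status (hb : b ≤ F) (σ : Prop) [Decidable σ] (i : Fin F) :
    ∑ A : {A : Finset (Fin F) // A.card = b}, (if i ∈ A.1 ↔ σ then (1 : ℝ) else 0) =
      F.choose b * statusProb F b σ := by
  have h := sum_notMem hb i
  by_cases hσ : σ
  · have h1 : ∀ A : {A : Finset (Fin F) // A.card = b}, (if i ∈ A.1 ↔ σ then (1 : ℝ) else 0) =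
        1 - if i ∉ A.1 then (1 : ℝ) else 0 := by
      intro A
      by_cases hA : i ∈ A.1 <;> simp [hA, hσ]
    simp only [h1, Finset.sum_sub_distrib, h, statusProb, if_pos hσ]
    simp only [Finset.sum_const, Finset.card_univ, card_subtype_card_eq, nsmul_eq_mul]
    ring
  · simp only [hσ, iff_false, h, statusProb, if_false]

/-- Complementing both indicators does not change their covariance. -/
theorem sum_status_mul_status_le (hb : b ≤ F) (σ : Prop) [Decidable σ] {i j : Fin F}
    (hij : i ≠ j) :
    ∑ A : {A : Finset (Fin F) // A.card = b},
      (if i ∈ A.1 ↔ σ then (1 : ℝ) else 0) * (if j ∈ A.1 ↔ σ then (1 : ℝ) else 0) ≤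
      F.choose b * statusProb F b σ ^ 2 := by
  have h := sum_notMem_mul_notMem_le hb hij
  by_cases hσ : σ
  · have h1 : ∀ (i : Fin F) (A : {A : Finset (Fin F) // A.card = b}),
        (if i ∈ A.1 ↔ σ then (1 : ℝ) else 0) = 1 - if i ∉ A.1 then (1 : ℝ) else 0 := by
      intro i A
      by_cases hA : i ∈ A.1 <;> simp [hA, hσ]
    have h2 : ∀ x y : ℝ, (1 - x) * (1 - y) = 1 - x - y + x * y := fun x y => by ring
    simp only [h1, h2, Finset.sum_add_distrib, Finset.sum_sub_distrib, sum_notMem hb]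
    simp only [Finset.sum_const, Finset.card_univ, card_subtype_card_eq, nsmul_eq_mul, statusProb,
      if_pos hσ]
    nlinarith
  · simpa only [hσ, iff_false, statusProb, if_false] using h

end Subsets

/-! ### Chebyshev bound for the number of points with a given pattern -/

section Variance

variable {ι : Type*} [Fintype ι] [DecidableEq ι] {F b : ℕ} (σ : ι → Prop) [DecidablePred σ]

/-- The number of points whose membership pattern in the sets `Z k` is `σ`. -/
def patternCount (Z : ι → {A : Finset (Fin F) // A.card = b}) : ℝ :=
  ∑ i : Fin F, ∏ k, if i ∈ (Z k).1 ↔ σ k then (1 : ℝ) else 0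

theorem sum_patternCount (hb : b ≤ F) :
    ∑ Z : ι → {A : Finset (Fin F) // A.card = b}, patternCount σ Z =
      (F.choose b : ℝ) ^ Fintype.card ι * (F * ∏ k, statusProb F b (σ k)) := by
  simp only [patternCount]
  rw [Finset.sum_comm]
  have h : ∀ i : Fin F, ∑ Z : ι → {A : Finset (Fin F) // A.card = b},
      ∏ k, (if i ∈ (Z k).1 ↔ σ k then (1 : ℝ) else 0) =
      (F.choose b : ℝ) ^ Fintype.card ι * ∏ k, statusProb F b (σ k) := by
    intro i
    rw [← Fintype.prod_sum fun k (A : {A : Finset (Fin F) // A.card = b}) =>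
      if i ∈ A.1 ↔ σ k then (1 : ℝ) else 0]
    simp only [sum_status hb, Finset.prod_mul_distrib, Finset.prod_const, Finset.card_univ]
  simp only [h, Finset.sum_const, Finset.card_univ, Fintype.card_fin, nsmul_eq_mul]
  ring

/-- Expand the square over pairs of points. The sets `Z k` are independent, so each pair factors
over `k`; distinct points contribute at most `P ^ 2`, equal points `P`. The variance is therefore at
most `F * P`. -/
theorem sum_patternCount_sq_le (hb : b ≤ F) :
    ∑ Z : ι → {A : Finset (Fin F) // A.card = b}, patternCount σ Z ^ 2 ≤
      (F.choose b : ℝ) ^ Fintype.card ι *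
        (F * ∏ k, statusProb F b (σ k) + (F * ∏ k, statusProb F b (σ k)) ^ 2) := by
  set P := ∏ k, statusProb F b (σ k) with hP
  have hP0 : 0 ≤ P := Finset.prod_nonneg fun k _ => statusProb_nonneg hb _
  set C := (F.choose b : ℝ) ^ Fintype.card ι
  have h : ∀ i j : Fin F, ∑ Z : ι → {A : Finset (Fin F) // A.card = b},
      (∏ k, (if i ∈ (Z k).1 ↔ σ k then (1 : ℝ) else 0)) *
        (∏ k, (if j ∈ (Z k).1 ↔ σ k then (1 : ℝ) else 0)) ≤
      C * ((if i = j then P else 0) + P ^ 2) := by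
    intro i j
    simp only [← Finset.prod_mul_distrib]
    rw [← Fintype.prod_sum fun k (A : {A : Finset (Fin F) // A.card = b}) =>
      (if i ∈ A.1 ↔ σ k then (1 : ℝ) else 0) * (if j ∈ A.1 ↔ σ k then (1 : ℝ) else 0)]
    split_ifs with hij
    · subst hij
      simp only [mul_ite, mul_one, mul_zero, ← ite_and, and_self]
      simp only [sum_status hb, Finset.prod_mul_distrib, Finset.prod_const, Finset.card_univ,
        ← hP, C]
      gcongr
      nlinarith
    · calc _ ≤ ∏ k, (F.choose b : ℝ) * statusProb F b (σ k) ^ 2 :=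
            Finset.prod_le_prod (fun k _ => Finset.sum_nonneg fun A _ => by positivity)
              fun k _ => sum_status_mul_status_le hb (σ k) hij
        _ = C * P ^ 2 := by
            rw [Finset.prod_mul_distrib, Finset.prod_const, Finset.prod_pow, Finset.card_univ]
        _ = _ := by ring
  have h2 : ∀ Z : ι → {A : Finset (Fin F) // A.card = b}, patternCount σ Z ^ 2 =
      ∑ i : Fin F, ∑ j : Fin F, (∏ k, (if i ∈ (Z k).1 ↔ σ k then (1 : ℝ) else 0)) *
        (∏ k, (if j ∈ (Z k).1 ↔ σ k then (1 : ℝ) else 0)) := by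
    intro Z
    rw [sq, patternCount, Finset.sum_mul_sum]
  simp only [h2]
  rw [Finset.sum_comm]
  calc _ = ∑ i : Fin F, ∑ j : Fin F, ∑ Z : ι → {A : Finset (Fin F) // A.card = b},
        (∏ k, (if i ∈ (Z k).1 ↔ σ k then (1 : ℝ) else 0)) *
        (∏ k, (if j ∈ (Z k).1 ↔ σ k then (1 : ℝ) else 0)) :=
        Finset.sum_congr rfl fun i _ => Finset.sum_comm
    _ ≤ ∑ i : Fin F, ∑ j : Fin F, C * ((if i = j then P else 0) + P ^ 2) :=
        Finset.sum_le_sum fun i _ => Finset.sum_le_sum fun j _ => h i j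
    _ = _ := by
        simp only [← Finset.mul_sum, Finset.sum_add_distrib, Finset.sum_ite_eq, Finset.mem_univ,
          if_true, Finset.sum_const, Finset.card_univ, Fintype.card_fin, nsmul_eq_mul]
        ring

theorem uniformProb_patternCount_le (hb : b ≤ F) (hF : 0 < F) {η : ℝ} (hη : 0 < η) :
    uniformProb (fun Z : ι → {A : Finset (Fin F) // A.card = b} =>
      η ≤ |patternCount σ Z / F - ∏ k, statusProb F b (σ k)|) ≤ 1 / (η ^ 2 * F) := by
  set P := ∏ k, statusProb F b (σ k) with hP
  have hP1 : P ≤ 1 := Finset.prod_le_one (fun k _ => statusProb_nonneg hb _)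
    fun k _ => statusProb_le_one hb _
  have hF0 : (0 : ℝ) < F := by exact_mod_cast hF
  have hcard : (Fintype.card (ι → {A : Finset (Fin F) // A.card = b}) : ℝ) =
      (F.choose b : ℝ) ^ Fintype.card ι := by
    rw [Fintype.card_fun, card_subtype_card_eq]
    push_cast
    rfl
  have hvar : ∑ Z : ι → {A : Finset (Fin F) // A.card = b}, (patternCount σ Z - F * P) ^ 2 ≤
      F * Fintype.card (ι → {A : Finset (Fin F) // A.card = b}) := by
    have h1 := sum_patternCount σ hb
    have h2 := sum_patternCount_sq_le σ hb
    rw [← hP, ← hcard] at h1 h2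
    have h3 : ∀ Z : ι → {A : Finset (Fin F) // A.card = b}, (patternCount σ Z - F * P) ^ 2 =
        patternCount σ Z ^ 2 - 2 * (F * P) * patternCount σ Z + (F * P) ^ 2 := fun Z => by ring
    simp only [h3, Finset.sum_add_distrib, Finset.sum_sub_distrib, ← Finset.mul_sum, h1,
      Finset.sum_const, Finset.card_univ, nsmul_eq_mul]
    set M := (Fintype.card (ι → {A : Finset (Fin F) // A.card = b}) : ℝ) with hM
    have : M * (F * P) ≤ M * (F * 1) := by gcongr
    linarith
  have h := uniformProb_abs_ge_le _ (mul_pos hη hF0) hvar hF0.le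
  calc _ ≤ _ := uniformProb_mono fun Z hZ => ?_
    _ ≤ _ := h
    _ = _ := by field_simp
  rw [div_sub' hF0.ne', abs_div, abs_of_pos hF0, le_div_iff₀ hF0] at hZ
  exact hZ

end Variance

/-! ### Fragment sizes under the random placement -/

section Fragments

variable {K N F b : ℕ}

theorem patternCount_eq_card_fragment (Z : Placement K N F b) (n : Fin N) (τ : Finset (Fin K)) :
    patternCount (fun k => k ∈ τ) (fun k => Z k n) = (fragment Z n τ).card := by
  simp only [patternCount, Finset.prod_boole, Finset.sum_boole, fragment, Finset.mem_univ,
    true_implies]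

theorem prod_statusProb (τ : Finset (Fin K)) :
    ∏ k, statusProb F b (k ∈ τ) = (b / F : ℝ) ^ τ.card * (1 - b / F : ℝ) ^ (K - τ.card) := by
  simp only [statusProb, Finset.prod_ite, Finset.prod_const, Finset.filter_mem_eq_inter,
    Finset.univ_inter]
  rw [Finset.filter_not, Finset.card_sdiff_of_subset (Finset.filter_subset _ _)]
  simp

theorem uniformProb_placement (hb : b ≤ F) (n : Fin N)
    (E : (Fin K → {A : Finset (Fin F) // A.card = b}) → Prop) :
    uniformProb (fun Z : Placement K N F b => E fun k => Z k n) = uniformProb E := by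
  obtain ⟨A, -, hA⟩ := Finset.exists_subset_card_eq (s := (univ : Finset (Fin F))) (n := b)
    (by simpa using hb)
  have : Nonempty {A : Finset (Fin F) // A.card = b} := ⟨⟨A, hA⟩⟩
  let e : Placement K N F b ≃ (Fin K → {A : Finset (Fin F) // A.card = b}) ×
      (Fin K → {j : Fin N // j ≠ n} → {A : Finset (Fin F) // A.card = b}) :=
    (Equiv.piCongrRight fun _ => Equiv.funSplitAt n _).trans
      (Equiv.arrowProdEquivProdArrow _ _ _)
  exact (uniformProb_comp_equiv e fun p => E p.1).trans (uniformProb_comp_fst E)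

theorem uniformProb_fragment_le (hb : b ≤ F) (hF : 0 < F) {η : ℝ} (hη : 0 < η) (n : Fin N)
    (τ : Finset (Fin K)) :
    uniformProb (fun Z : Placement K N F b => η ≤ |((fragment Z n τ).card / F : ℝ) -
      (b / F : ℝ) ^ τ.card * (1 - b / F : ℝ) ^ (K - τ.card)|) ≤ 1 / (η ^ 2 * F) := by
  have h := uniformProb_patternCount_le (fun k => k ∈ τ) hb hF hη
  rw [← uniformProb_placement hb n] at h
  simpa only [patternCount_eq_card_fragment, prod_statusProb] using h

theorem floor_mul_le {q : ℝ} (hq : q ≤ 1) (F : ℕ) : ⌊q * F⌋₊ ≤ F :=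
  Nat.floor_le_of_le (mul_le_of_le_one_left (by positivity) hq)

/-- One half of `η` covers the deviation from the mean, the other the convergence of `⌊q * F⌋₊ / F`
to `q`; the number of pairs `(n, τ)` does not depend on `F`. -/
theorem eventually_uniformProb_fragment_le (K N : ℕ) {q : ℝ} (hq₀ : 0 ≤ q) (hq₁ : q ≤ 1)
    {η ε : ℝ} (hη : 0 < η) (hε : 0 < ε) :
    ∀ᶠ F : ℕ in atTop, uniformProb (fun Z : Placement K N F ⌊q * F⌋₊ =>
      ∃ p : Fin N × Finset (Fin K), ¬ |((fragment Z p.1 p.2).card / F : ℝ) -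
        q ^ p.2.card * (1 - q) ^ (K - p.2.card)| ≤ η) ≤ ε := by
  have hfloor : Tendsto (fun F : ℕ => (⌊q * F⌋₊ / F : ℝ)) atTop (𝓝 q) :=
    (tendsto_nat_floor_mul_div_atTop hq₀).comp tendsto_natCast_atTop_atTop
  have h1 : ∀ᶠ F : ℕ in atTop, ∀ τ : Finset (Fin K),
      |(⌊q * F⌋₊ / F : ℝ) ^ τ.card * (1 - ⌊q * F⌋₊ / F : ℝ) ^ (K - τ.card) -
        q ^ τ.card * (1 - q) ^ (K - τ.card)| < η / 2 := by
    refine eventually_all.2 fun τ => ?_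
    have := (hfloor.pow τ.card).mul (((tendsto_const_nhds (x := (1 : ℝ))).sub hfloor).pow (K - τ.card))
    simpa [Real.dist_eq] using Metric.tendsto_nhds.1 this (η / 2) (by positivity)
  have h2 : ∀ᶠ F : ℕ in atTop, (Fintype.card (Fin N × Finset (Fin K)) : ℝ) *
      (1 / ((η / 2) ^ 2 * F)) < ε := by
    have : Tendsto (fun F : ℕ => (Fintype.card (Fin N × Finset (Fin K)) : ℝ) *
        (1 / ((η / 2) ^ 2 * F))) atTop
        (𝓝 ((Fintype.card (Fin N × Finset (Fin K)) : ℝ) * 0)) := by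
      refine tendsto_const_nhds.mul ?_
      simp only [one_div]
      exact tendsto_inv_atTop_zero.comp
        (tendsto_natCast_atTop_atTop.const_mul_atTop (by positivity))
    rw [mul_zero] at this
    exact this.eventually_lt_const hε
  filter_upwards [h1, h2, eventually_gt_atTop 0] with F h1 h2 hF
  refine le_trans (uniformProb_exists_le_card_mul _ fun p => ?_) h2.le
  refine le_trans (uniformProb_mono fun Z hZ => ?_)
    (uniformProb_fragment_le (floor_mul_le hq₁ F) hF (half_pos hη) p.1 p.2)
  by_contra! hlt
  refine hZ ?_
  calc _ = _ := by rw [← sub_add_sub_cancel]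
    _ ≤ _ := abs_add_le _ _
    _ ≤ η / 2 + η / 2 := add_le_add hlt.le (h1 p.2).le
    _ = η := add_halves η

end Fragments

end

section

open Finset

/-! ### Coding delay and storage -/

/-- The normalized length of the messages of round `s`, for a library of large files. -/
def messageRate (K L : ℕ) (q : ℝ) (s : ℕ) : ℝ :=
  q ^ (s - 1) * (1 - q) ^ (K - s + 1) / (miniCount K L s : ℝ)

theorem le_ceilDiv_mul {a c : ℕ} (hc : 0 < c) : a ≤ (a ⌈/⌉ c) * c := by
  rw [mul_comm]
  exact le_smul_ceilDiv (b := a) hc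

theorem ceilDiv_mul_le (a c : ℕ) : (a ⌈/⌉ c) * c ≤ a + c := by
  rw [Nat.ceilDiv_eq_add_pred_div]
  exact (Nat.div_mul_le_self _ _).trans (Nat.sub_le _ _)

section Lengths

variable {K L N F b m f : ℕ} {q η : ℝ} {Z : Placement K N F b}

/-- Rounding up costs less than one symbol, that is `1 / f`, and division by the number of
mini-files does not enlarge the error. -/
theorem abs_miniLength_div_sub_le (hm : 1 ≤ m) (hf : 1 ≤ f) (hF : F = m * f)
    {n : Fin N} {τ : Finset (Fin K)} {p : ℝ} (h : |((fragment Z n τ).card / F : ℝ) - p| ≤ η) :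
    |(miniLength m L Z n τ : ℝ) / f - p / miniCount K L (τ.card + 1)| ≤ η + 1 / f := by
  have hc : 0 < miniCount K L (τ.card + 1) := miniCount_pos
  set c := miniCount K L (τ.card + 1) with hcdef
  have hc1 : (1 : ℝ) ≤ c := by exact_mod_cast hc
  have hm0 : (0 : ℝ) < m := by exact_mod_cast hm
  have hf0 : (0 : ℝ) < f := by exact_mod_cast hf
  have h1 : ((fragment Z n τ).card : ℝ) ≤ miniLength m L Z n τ * (m * c) := by
    exact_mod_cast le_ceilDiv_mul (Nat.mul_pos hm hc)
  have h2 : (miniLength m L Z n τ : ℝ) * (m * c) ≤ (fragment Z n τ).card + m * c := by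
    exact_mod_cast ceilDiv_mul_le (fragment Z n τ).card (m * c)
  have hF' : (F : ℝ) = m * f := by exact_mod_cast hF
  rw [hF'] at h
  set x := ((fragment Z n τ).card : ℝ)
  set l := (miniLength m L Z n τ : ℝ)
  have hη : 0 ≤ η := (abs_nonneg _).trans h
  have e1 : x / (m * f) / c ≤ l / f := by
    rw [div_div, div_le_div_iff₀ (by positivity) hf0]
    nlinarith
  have e2 : l / f ≤ x / (m * f) / c + 1 / f := by
    have : x / (m * f) / c + 1 / f = (x + m * c) / (m * c) / f := by field_simp
    rw [this]
    gcongr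
    rwa [le_div_iff₀ (by positivity)]
  have e3 : |x / (m * f) / c - p / c| ≤ η := by
    rw [← sub_div, abs_div, abs_of_pos (zero_lt_one.trans_le hc1)]
    exact (div_le_self (abs_nonneg _) hc1).trans h
  rw [abs_le] at e3 ⊢
  have : 0 ≤ 1 / (f : ℝ) := by positivity
  constructor <;> linarith

/-- Both suprema run over nonempty sets and are attained, so an estimate for single mini-files
passes to blocks. -/
theorem exists_blockLength_eq (hL : 1 ≤ L) (d : Demand K N) (μ : Message K L) :
    ∃ n, ∃ τ : Finset (Fin K), τ.card + 1 = μ.round ∧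
      blockLength m Z d μ = miniLength m L Z n τ := by
  have hs := Finset.mem_Icc.1 μ.1.2
  have hcard : μ.group.card = groupSize K L μ.round := (Finset.mem_powersetCard.1 μ.2.1.2).2
  obtain ⟨U, hU, hU'⟩ := Finset.exists_mem_eq_sup (powersetCard μ.round μ.group)
    (Finset.powersetCard_nonempty.2 (hcard ▸ le_groupSize hL hs.2))
    fun U => U.sup fun r => miniLength m L Z (d r) (U.erase r)
  rw [Finset.mem_powersetCard] at hU
  have hne : U.Nonempty := Finset.card_pos.1 (hU.2 ▸ hs.1)
  obtain ⟨r, hr, hr'⟩ := Finset.exists_mem_eq_sup U hne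
    fun r => miniLength m L Z (d r) (U.erase r)
  exact ⟨d r, U.erase r, by rw [Finset.card_erase_add_one hr, hU.2], hU'.trans hr'⟩

theorem abs_blockLength_div_sub_le (hL : 1 ≤ L) (hm : 1 ≤ m) (hf : 1 ≤ f) (hF : F = m * f)
    (hZ : ∀ n, ∀ τ : Finset (Fin K), |((fragment Z n τ).card / F : ℝ) -
      q ^ τ.card * (1 - q) ^ (K - τ.card)| ≤ η) (d : Demand K N) (μ : Message K L) :
    |(blockLength m Z d μ : ℝ) / f - messageRate K L q μ.round| ≤ η + 1 / f := by
  obtain ⟨n, τ, hτ, h⟩ := exists_blockLength_eq (m := m) (Z := Z) hL d μ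
  have h1 := abs_miniLength_div_sub_le (L := L) hm hf hF (hZ n τ)
  have hs := Finset.mem_Icc.1 μ.1.2
  have h2 : K - τ.card = K - μ.round + 1 := by
    change _ ∧ μ.round ≤ K at hs
    omega
  have h3 : τ.card = μ.round - 1 := by omega
  rwa [← h, hτ, h2, h3] at h1

theorem abs_sum_div_sub_le {ι : Type*} (s : Finset ι) (g : ι → ℕ) (r : ι → ℝ) {β : ℝ}
    (h : ∀ i ∈ s, |(g i : ℝ) / f - r i| ≤ β) :
    |((∑ i ∈ s, g i : ℕ) : ℝ) / f - ∑ i ∈ s, r i| ≤ s.card * β := by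
  rw [Nat.cast_sum, Finset.sum_div, ← Finset.sum_sub_distrib]
  refine (Finset.abs_sum_le_sum_abs _ _).trans ((Finset.sum_le_sum h).trans ?_)
  rw [Finset.sum_const, nsmul_eq_mul]

theorem sum_messageRate (K L : ℕ) (q : ℝ) :
    ∑ μ : Message K L, messageRate K L q μ.round =
      ∑ s ∈ Finset.Icc 1 K, (K.choose (groupSize K L s) : ℝ) *
        ((groupSize K L s - 1).choose (s - 1) : ℝ) * messageRate K L q s := by
  rw [Fintype.sum_sigma, ← Finset.sum_coe_sort (Finset.Icc 1 K)]
  refine Finset.sum_congr rfl fun s _ => ?_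
  simp only [Message.round, Finset.sum_const, Finset.card_univ, Fintype.card_prod,
    Fintype.card_coe, Finset.card_powersetCard, Fintype.card_fin, nsmul_eq_mul, Nat.cast_mul]

theorem sum_messageRate_group (hL : 1 ≤ L) (q : ℝ) (k : Fin K) :
    ∑ μ : Message K L with k ∈ μ.group, messageRate K L q μ.round =
      ∑ s ∈ Finset.Icc 1 K, ((K - 1).choose (groupSize K L s - 1) : ℝ) *
        ((groupSize K L s - 1).choose (s - 1) : ℝ) * messageRate K L q s := by
  rw [Finset.sum_filter, Fintype.sum_sigma, ← Finset.sum_coe_sort (Finset.Icc 1 K)]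
  refine Finset.sum_congr rfl fun s _ => ?_
  have hs := Finset.mem_Icc.1 s.2
  have h := card_filter_mem_powersetCard (Finset.mem_univ k)
    (hs.1.trans (le_groupSize hL hs.2))
  rw [Finset.card_fin] at h
  rw [Fintype.sum_prod_type]
  change ∑ S : powersetCard (groupSize K L s) (univ : Finset (Fin K)),
    ∑ _ω : Fin ((groupSize K L s - 1).choose (s - 1)),
      (if k ∈ S.1 then messageRate K L q s else 0) = _
  simp only [Finset.sum_const, Finset.card_univ, Fintype.card_fin, nsmul_eq_mul]
  rw [Finset.sum_coe_sort (powersetCard (groupSize K L s) (univ : Finset (Fin K))) fun S =>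
    ((groupSize K L s - 1).choose (s - 1) : ℝ) * if k ∈ S then messageRate K L q s else 0,
    ← Finset.mul_sum, ← Finset.sum_filter, Finset.sum_const, h, nsmul_eq_mul]
  ring

/-- The estimate of the block lengths is uniform in the demand, so it holds at a demand attaining
the maximum. -/
theorem abs_worstCaseSlots_div_sub_le (hL : 1 ≤ L) (hN : 1 ≤ N) (hm : 1 ≤ m) (hf : 1 ≤ f)
    (hF : F = m * f) (hZ : ∀ n, ∀ τ : Finset (Fin K), |((fragment Z n τ).card / F : ℝ) -
      q ^ τ.card * (1 - q) ^ (K - τ.card)| ≤ η) :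
    |(worstCaseSlots L m Z : ℝ) / f - ∑ μ : Message K L, messageRate K L q μ.round| ≤
      Fintype.card (Message K L) * (η + 1 / f) := by
  have : Nonempty (Demand K N) := ⟨fun _ => ⟨0, hN⟩⟩
  obtain ⟨d, -, hd⟩ := Finset.exists_mem_eq_sup (univ : Finset (Demand K N))
    Finset.univ_nonempty fun d => Fintype.card (Slot L m Z d)
  rw [worstCaseSlots, hd, Fintype.card_sigma]
  simp only [Fintype.card_fin]
  exact abs_sum_div_sub_le _ _ _ fun μ _ => abs_blockLength_div_sub_le hL hm hf hF hZ d μ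

theorem abs_keyBits_div_sub_le (hL : 1 ≤ L) (hN : 1 ≤ N) (hm : 1 ≤ m) (hf : 1 ≤ f)
    (hF : F = m * f) (hZ : ∀ n, ∀ τ : Finset (Fin K), |((fragment Z n τ).card / F : ℝ) -
      q ^ τ.card * (1 - q) ^ (K - τ.card)| ≤ η) (k : Fin K) :
    |(keyBits L m Z k : ℝ) / F - ∑ μ : Message K L with k ∈ μ.group,
      messageRate K L q μ.round| ≤ Fintype.card (Message K L) * (η + 1 / f) := by
  have : Nonempty (Demand K N) := ⟨fun _ => ⟨0, hN⟩⟩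
  have hm0 : (m : ℝ) ≠ 0 := by exact_mod_cast (Nat.pos_iff_ne_zero.1 hm)
  have hη : 0 ≤ η := (abs_nonneg _).trans (hZ ⟨0, hN⟩ ∅)
  have hsum : ∑ μ : {μ : Message K L // k ∈ μ.group}, keyLength m Z μ.1 =
      ∑ μ : Message K L with k ∈ μ.group, keyLength m Z μ :=
    (Finset.sum_subtype _ (by simp) _).symm
  have hF' : (F : ℝ) = m * f := by exact_mod_cast hF
  -- The `m` bits per key symbol cancel against `F = m * f`.
  rw [keyBits, hsum, hF', Nat.cast_mul, mul_div_mul_left _ _ hm0]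
  refine (abs_sum_div_sub_le _ _ _ fun μ _ => ?_).trans
    (mul_le_mul_of_nonneg_right (Nat.cast_le.2 (Finset.card_le_univ _)) (by positivity))
  obtain ⟨d, -, hd⟩ := Finset.exists_mem_eq_sup (univ : Finset (Demand K N))
    Finset.univ_nonempty fun d => blockLength m Z d μ
  rw [keyLength, hd]
  exact abs_blockLength_div_sub_le hL hm hf hF hZ d μ

theorem dataBits_eq (Z : Placement K N F b) (k : Fin K) : dataBits Z k = N * b := by
  simp [dataBits, fun n => (Z k n).2]

theorem abs_mul_floor_div_sub_le (N : ℕ) (hF : 1 ≤ F) (hq : 0 ≤ q) :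
    |((N * ⌊q * F⌋₊ : ℕ) : ℝ) / F - N * q| ≤ N / F := by
  have hF0 : (0 : ℝ) < F := by exact_mod_cast hF
  have h1 := Nat.floor_le (mul_nonneg hq hF0.le)
  have h2 := (Nat.lt_floor_add_one (q * F)).le
  have h3 : |((⌊q * F⌋₊ : ℕ) : ℝ) - q * F| ≤ 1 := abs_le.2 ⟨by linarith, by linarith⟩
  have h4 : ((N * ⌊q * F⌋₊ : ℕ) : ℝ) / F - N * q = N / F * ((⌊q * F⌋₊ : ℕ) - q * F) := by
    push_cast
    field_simp
  rw [h4, abs_mul, abs_of_nonneg (by positivity)]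
  exact mul_le_of_le_one_right (by positivity) h3

end Lengths

end

end SecureCaching

end

/-! ### Assembly: generic events and choice of the thresholds -/

namespace SecureCaching

open Filter

/-- Generic channels and coefficients give correct and secure delivery. -/
theorem delivery_of_generic {K L N F b m : ℕ} {𝔽 : Type} [Field 𝔽] [Fintype 𝔽]
    (repr : (Fin m → Bool) ≃ 𝔽) (hL : 1 ≤ L) (hm : 1 ≤ m) (hQ : K < Fintype.card 𝔽)
    {Z : Placement K N F b} {H : Matrix (Fin K) (Fin L) 𝔽} {h : Fin L → 𝔽}
    {φ : Coefficients K L 𝔽}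
    (hH : ∀ A : Finset (Fin K), A.card ≤ L → LinearIndepOn 𝔽 H (A : Set (Fin K)))
    (hh : h ⬝ᵥ 1 ≠ 0) (hφ : GenericCoefficients φ) :
    (∃ u, ZeroForcing H u) ∧
      ∀ u, ZeroForcing H u → ∀ d : Demand K N,
        (∀ k, Decodable repr Z H φ u d k) ∧
        ∀ P : PMF (Library N F), mutualInformation (eavesdropperLaw repr Z h φ u d P) = 0 :=
  ⟨exists_zeroForcing hL H hQ hH, fun _ hu d =>
    ⟨fun k => decodable repr hm hL hu hφ d k, mutualInformation_eavesdropperLaw repr hh d⟩⟩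

/-- The channels and the coefficients are generic with high probability over a large field. -/
theorem exists_uniformProb_not_generic_le (K L : ℕ) (hL : 1 ≤ L) :
    ∃ C : ℝ, 0 ≤ C ∧ ∀ (𝔽 : Type) [Field 𝔽] [Fintype 𝔽],
      uniformProb (fun ω : Matrix (Fin K) (Fin L) 𝔽 × (Fin L → 𝔽) × Coefficients K L 𝔽 =>
        ¬ ((∀ A : Finset (Fin K), A.card ≤ L → LinearIndepOn 𝔽 ω.1 (A : Set (Fin K))) ∧
          ω.2.1 ⬝ᵥ 1 ≠ 0 ∧ GenericCoefficients ω.2.2)) ≤ C / Fintype.card 𝔽 := by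
  set I := (Σ s : Finset.Icc 1 K,
    Finset.powersetCard (groupSize K L s) (Finset.univ : Finset (Fin K))) × Fin K
  refine ⟨Fintype.card (Finset (Fin K)) * L + (1 + Fintype.card I * 2 ^ K), by positivity,
    fun 𝔽 _ _ => ?_⟩
  have : Finite (Matrix (Fin K) (Fin L) 𝔽) := inferInstanceAs (Finite (Fin K → Fin L → 𝔽))
  have : Nonempty (Matrix (Fin K) (Fin L) 𝔽) := ⟨0⟩
  have h1 := uniformProb_comp_fst (A := Matrix (Fin K) (Fin L) 𝔽)
    (B := (Fin L → 𝔽) × Coefficients K L 𝔽) fun H =>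
      ∃ A : Finset (Fin K), ¬ (A.card ≤ L → LinearIndepOn 𝔽 H (A : Set (Fin K)))
  have h2 := (uniformProb_comp_snd (A := Matrix (Fin K) (Fin L) 𝔽)
    (B := (Fin L → 𝔽) × Coefficients K L 𝔽) fun p => p.1 ⬝ᵥ 1 = 0).trans
      (uniformProb_comp_fst (B := Coefficients K L 𝔽) fun h : Fin L → 𝔽 => h ⬝ᵥ 1 = 0)
  have h3 := (uniformProb_comp_snd (A := Matrix (Fin K) (Fin L) 𝔽)
    (B := (Fin L → 𝔽) × Coefficients K L 𝔽) fun p => ¬ GenericCoefficients p.2).trans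
      (uniformProb_comp_snd (A := Fin L → 𝔽) fun φ : Coefficients K L 𝔽 =>
        ¬ GenericCoefficients φ)
  have h1' := h1.trans_le uniformProb_exists_not_linearIndepOn_le
  have h2' := h2.trans_le (uniformProb_sum_eq_zero_le hL)
  have h3' := h3.trans_le (uniformProb_not_genericCoefficients_le K L)
  rw [mul_div_assoc'] at h1' h3'
  rw [add_div, add_div]
  refine le_trans (uniformProb_mono fun ω hω => ?_) ((uniformProb_or_le _ _).trans
    (add_le_add h1' ((uniformProb_or_le _ _).trans (add_le_add h2' h3'))))
  by_contra! hcon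
  exact hω hcon

end SecureCaching

theorem theorem4 (K L N : ℕ) (hK : 1 ≤ K) (hL : 1 ≤ L) (hKN : K ≤ N)
    (q : ℝ) (hq₀ : 0 ≤ q) (hq₁ : q ≤ 1) (T M_D M_K : ℝ)
    (hT : T = ∑ s ∈ Finset.Icc 1 K,
      (K.choose (min (s + L - 1) K) : ℝ) * q ^ (s - 1) * (1 - q) ^ (K - s + 1) /
          ((K - s).choose (min (s + L - 1) K - s) : ℝ) *
        ((min (s + L - 1) K - 1).choose (s - 1) : ℝ))
    (hM_D : M_D = N * q)
    (hM_K : M_K = ∑ s ∈ Finset.Icc 1 K,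
      ((K - 1).choose (min (s + L - 1) K - 1) : ℝ) *
            ((min (s + L - 1) K - 1).choose (s - 1) : ℝ) /
          ((K - s).choose (min (s + L - 1) K - s) : ℝ) *
        (q ^ (s - 1) * (1 - q) ^ (K - s + 1)))
    (ε δ : ℝ) (hε : 0 < ε) (hδ : 0 < δ) :
    ∃ m₀ f₀ : ℕ, ∀ m ≥ m₀, ∀ f ≥ f₀,
      ∀ (𝔽 : Type) [Field 𝔽] [Fintype 𝔽], Fintype.card 𝔽 = 2 ^ m →
      ∀ (repr : (Fin m → Bool) ≃ 𝔽) (F b : ℕ), F = m * f → b = ⌊q * F⌋₊ →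
        1 - ε ≤ SecureCaching.uniformProb
          fun ω : SecureCaching.Realization K L N F b 𝔽 =>
            let Z := ω.1
            let H := ω.2.1
            let h := ω.2.2.1
            let φ := ω.2.2.2
            -- beamforming vectors exist, and every choice of them gives correct, secure delivery
            (∃ u, SecureCaching.ZeroForcing H u) ∧
            (∀ u, SecureCaching.ZeroForcing H u →
              ∀ d : SecureCaching.Demand K N,
                (∀ k, SecureCaching.Decodable repr Z H φ u d k) ∧
                ∀ P : PMF (SecureCaching.Library N F),
                  SecureCaching.mutualInformation
                    (SecureCaching.eavesdropperLaw repr Z h φ u d P) = 0) ∧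
            -- coding delay and storage
            |(SecureCaching.worstCaseSlots L m Z : ℝ) / f - T| ≤ δ ∧
            ∀ k, SecureCaching.dataBits Z k = N * b ∧
              |(SecureCaching.dataBits Z k : ℝ) / F - M_D| ≤ δ ∧
              |(SecureCaching.keyBits L m Z k : ℝ) / F - M_K| ≤ δ := by
  classical
  have hN : 1 ≤ N := hK.trans hKN
  set M := Fintype.card (SecureCaching.Message K L) with hM
  have hT' : T = ∑ μ : SecureCaching.Message K L, SecureCaching.messageRate K L q μ.round := by
    rw [SecureCaching.sum_messageRate, hT]
    refine Finset.sum_congr rfl fun s _ => ?_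
    simp only [SecureCaching.messageRate, SecureCaching.miniCount, SecureCaching.groupSize]
    ring
  have hM_K' : ∀ k : Fin K, M_K = ∑ μ : SecureCaching.Message K L with k ∈ μ.group,
      SecureCaching.messageRate K L q μ.round := by
    intro k
    rw [SecureCaching.sum_messageRate_group hL, hM_K]
    refine Finset.sum_congr rfl fun s _ => ?_
    simp only [SecureCaching.messageRate, SecureCaching.miniCount, SecureCaching.groupSize]
    ring
  obtain ⟨C, hC0, hC⟩ := SecureCaching.exists_uniformProb_not_generic_le K L hL
  -- Chosen so that `M * (η + 1 / f) ≤ δ` once `1 / f ≤ η`; the `+ 1` makes the denominator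
  -- positive.
  set η := δ / (2 * (M + 1)) with hη
  have hη0 : 0 < η := by positivity
  obtain ⟨F₀, hF₀⟩ := Filter.eventually_atTop.1
    (SecureCaching.eventually_uniformProb_fragment_le K N hq₀ hq₁ hη0 (half_pos hε))
  -- Since `m < 2 ^ m`, the bounds on `m` give `K < |𝔽|` and `C / |𝔽| ≤ ε / 2`. Those on `f` give `F
  -- ≥ F₀`, `1 / f ≤ η` and `N / F ≤ δ`, using `f ≤ F`.
  refine ⟨max (K + 1) ⌈C / (ε / 2)⌉₊, max (max 1 F₀) (max ⌈1 / η⌉₊ ⌈N / δ⌉₊),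
    fun m hm f hf 𝔽 _ _ hQ repr F b hF hb => ?_⟩
  subst hb
  simp only [ge_iff_le, max_le_iff] at hm hf
  obtain ⟨hm1, hm2⟩ := hm
  obtain ⟨⟨hf1, hf2⟩, hf3, hf4⟩ := hf
  have hm0 : 1 ≤ m := by omega
  have hfF : f ≤ F := hF ▸ Nat.le_mul_of_pos_left f hm0
  have hmQ : m < Fintype.card 𝔽 := hQ ▸ Nat.lt_two_pow_self
  have hKQ : K < Fintype.card 𝔽 := by omega
  have hf0 : (0 : ℝ) < f := by exact_mod_cast hf1
  have hF0 : (0 : ℝ) < F := hf0.trans_le (by exact_mod_cast hfF)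
  have hMη : M * (η + 1 / f) ≤ δ := by
    have h1 : 1 / (f : ℝ) ≤ η := by
      rw [one_div_le hf0 hη0]
      exact Nat.ceil_le.1 hf3
    calc M * (η + 1 / f) ≤ (M + 1) * (η + η) := by gcongr; linarith
      _ = δ := by rw [hη]; field_simp; ring
  have hNF : (N / F : ℝ) ≤ δ := by
    rw [div_le_comm₀ hF0 hδ]
    exact (Nat.ceil_le.1 hf4).trans (by exact_mod_cast hfF)
  obtain ⟨A, -, hA⟩ := Finset.exists_subset_card_eq (s := (Finset.univ : Finset (Fin F)))
    (n := ⌊q * F⌋₊) (by simpa using SecureCaching.floor_mul_le hq₁ F)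
  have : Nonempty (SecureCaching.Placement K N F ⌊q * F⌋₊) := ⟨fun _ _ => ⟨A, hA⟩⟩
  have : Finite (Matrix (Fin K) (Fin L) 𝔽) := inferInstanceAs (Finite (Fin K → Fin L → 𝔽))
  have : Nonempty (Matrix (Fin K) (Fin L) 𝔽) := ⟨0⟩
  have hZ := (SecureCaching.uniformProb_comp_fst
    (B := Matrix (Fin K) (Fin L) 𝔽 × (Fin L → 𝔽) × SecureCaching.Coefficients K L 𝔽) _).trans_le
    (hF₀ F (hf2.trans hfF))
  have hgen := (SecureCaching.uniformProb_comp_snd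
    (A := SecureCaching.Placement K N F ⌊q * F⌋₊) _).trans_le (hC 𝔽)
  have hCQ : C / Fintype.card 𝔽 ≤ ε / 2 := by
    rw [div_le_comm₀ (by exact_mod_cast Fintype.card_pos) (half_pos hε)]
    exact (Nat.ceil_le.1 hm2).trans (by exact_mod_cast hmQ.le)
  -- Failure lies in the union of a fragment deviation and a non-generic draw, each of probability
  -- at most `ε / 2`.
  rw [← sub_le_comm, ← SecureCaching.uniformProb_not]
  refine le_trans (SecureCaching.uniformProb_mono fun ω hω => ?_)
    ((SecureCaching.uniformProb_or_le _ _).trans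
      ((add_le_add hZ (hgen.trans hCQ)).trans_eq (add_halves ε)))
  by_contra hcon
  rw [not_or, not_not] at hcon
  obtain ⟨hfrag, hH, hh, hφ⟩ := hcon
  have hfrag' : ∀ n, ∀ τ : Finset (Fin K), |((SecureCaching.fragment ω.1 n τ).card / F : ℝ) -
      q ^ τ.card * (1 - q) ^ (K - τ.card)| ≤ η := fun n τ => by
    by_contra h
    exact hfrag ⟨(n, τ), h⟩
  obtain ⟨hu, hdel⟩ := SecureCaching.delivery_of_generic repr hL hm0 hKQ hH hh hφ
  refine hω ⟨hu, hdel, ?_, fun k => ⟨SecureCaching.dataBits_eq _ k, ?_, ?_⟩⟩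
  · rw [hT']
    exact (SecureCaching.abs_worstCaseSlots_div_sub_le hL hN hm0 hf1 hF hfrag').trans hMη
  · rw [SecureCaching.dataBits_eq, hM_D]
    exact (SecureCaching.abs_mul_floor_div_sub_le N (hf1.trans hfF) hq₀).trans hNF
  · rw [hM_K' k]
    exact (SecureCaching.abs_keyBits_div_sub_le hL hN hm0 hf1 hF hfrag' k).trans hMη
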